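/- For bounded complex sequences $a,b,c$ on $\mathbb Z$ let $J=J(a,b,c)$ be the Jacobi operator on $\ell^2(\mathbb Z)$, $(Ju)_k=a_{k-1}u_{k-1}+b_ku_k+c_ku_{k+1}$, and let $v_k:=\max\{|a_{k-1}-1|,|a_k-1|,|b_k|,|c_{k-1}-1|,|c_k-1|\}$. Let $\sigma_{\rm d}(J)$ be its discrete spectrum (isolated eigenvalues of finite algebraic multiplicity). For $p\ge 1$, $f:[0,\infty)\to(0,\infty)$ and $0\ne v\in\ell^p(\mathbb Z)$ put $$R_{p,f}(J):=\frac1{\|v\|_{\ell^p}^p}\sum_{\lambda\in\sigma_{\rm d}(J)}\frac{\operatorname{dist}(\lambda,[-2,2])^p}{|\lambda^2-4|^{1/2}}\,f\!\left(-\log\frac{\operatorname{dist}(\lambda,[-2,2])}{\operatorname{dist}(\lambda,\{-2,2\})}\right)\in[0,\infty],$$ where each eigenvalue is repeated according to its algebraic multiplicity. For an integer $n\ge 2$ let $J_n$ be the Jacobi operator with $a_k=c_k=1$ for all $k$, $b_k=\mathrm i\,n^{-2/3}$ for $1\le k\le n$ and $b_k=0$ for all other $k$. Write $F(x):=\int_0^x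 f(t)\,dt$. **Theorem.** For every $p\ge1$ there is a constant $C_p>0$, depending only on $p$, such that the following holds. Let $0<\varepsilon<2/3<\gamma<1$ and $x_0\ge1$, and let $g:[1,\infty)\to[1,\infty)$ satisfy $g(n)\to\infty$ and $g(n)/n^{\gamma-2/3}\to0$ as $n\to\infty$. Then there is $n_*\ge2$ such that for all integers $n\ge n_*$ and all continuous, non-decreasing functions $f:[0,\infty)\to(0,\infty)$ for which $t\mapsto f(\log t^2)/t$ is monotonic on $[x_0,\infty)$: $$\sup_{J:\,0\ne v\in\ell^p(\mathbb Z)}R_{p,f}(J)\;\ge\;R_{p,f}(J_n)\;\ge\;C_p\Big[F\big(\log(\pi^2n^{\varepsilon})\big)-F\big(\log(\pi^2g(n)^2)\big)\Big],\qquad R_{p,f}(J_n)\;\ge\;C_p\,f(0)\,\log\frac{n^{\varepsilon}}{g(n)^2},$$ and, whenever $g(n)^2\le n^{\varepsilon}$, also $$C_p\Big[F\big(\log(\pi^2n^{\varepsilon})\big)-F\big(\log(\pi^2g(n)^2)\big)\Big]\;\ge\;C_p\,f(0)\,\log\frac{n^{\varepsilon}}{g(n)^2}.$$ -/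

import Mathlib

open Filter Topology
open scoped ENNReal lp

noncomputable section

namespace JacobiLT

/-- Multiplication by a bounded complex sequence, as a bounded operator on `ℓ²(ℤ)`. -/
def mulOp (m : ℓ^∞(ℤ, ℂ)) : ℓ^2(ℤ, ℂ) →L[ℂ] ℓ^2(ℤ, ℂ) :=
  lp.mapCLM 2 (fun k => m k • ContinuousLinearMap.id ℂ ℂ) (norm_nonneg m) (fun k => by
    rw [norm_smul]
    simpa using lp.norm_apply_le_norm (by simp) m k)

theorem mulOp_apply (m : ℓ^∞(ℤ, ℂ)) (u : ℓ^2(ℤ, ℂ)) (k : ℤ) : mulOp m u k = m k * u k := by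
  simp [mulOp]

theorem memℓp_shift (s : ℤ) (u : ℓ^2(ℤ, ℂ)) : Memℓp (fun k : ℤ => u (k + s)) 2 := by
  have h := (lp.memℓp u).summable (by norm_num)
  exact memℓp_gen ((Equiv.addRight s).summable_iff.mpr h)

/-- The shift `(S u)_k = u_{k+s}` on `ℓ²(ℤ)`. -/
def shiftOp (s : ℤ) : ℓ^2(ℤ, ℂ) →L[ℂ] ℓ^2(ℤ, ℂ) :=
  LinearMap.mkContinuous
    { toFun := fun u => ⟨fun k => u (k + s), memℓp_shift s u⟩
      map_add' := fun _ _ => rfl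
      map_smul' := fun _ _ => rfl }
    1 (fun u => by
      have h2 : (0 : ℝ) < (2 : ℝ≥0∞).toReal := by norm_num
      rw [one_mul, lp.norm_eq_tsum_rpow h2, lp.norm_eq_tsum_rpow h2]
      exact le_of_eq (congrArg (fun x : ℝ => x ^ (1 / (2 : ℝ≥0∞).toReal))
        ((Equiv.addRight s).tsum_eq (fun k => ‖u k‖ ^ (2 : ℝ≥0∞).toReal))))

theorem shiftOp_apply (s : ℤ) (u : ℓ^2(ℤ, ℂ)) (k : ℤ) : shiftOp s u k = u (k + s) := rfl

/-- The Jacobi operator on `ℓ²(ℤ)` with bounded coefficient sequences `a`, `b`, `c`. -/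
def jacobi (a b c : ℓ^∞(ℤ, ℂ)) : ℓ^2(ℤ, ℂ) →L[ℂ] ℓ^2(ℤ, ℂ) :=
  shiftOp (-1) ∘L mulOp a + mulOp b + mulOp c ∘L shiftOp 1

theorem jacobi_apply (a b c : ℓ^∞(ℤ, ℂ)) (u : ℓ^2(ℤ, ℂ)) (k : ℤ) :
    jacobi a b c u k = a (k - 1) * u (k - 1) + b k * u k + c k * u (k + 1) := by
  simp [jacobi, mulOp_apply, shiftOp_apply, sub_eq_add_neg]

/-- The sequence `v_k = max {|a_{k-1}-1|, |a_k-1|, |b_k|, |c_{k-1}-1|, |c_k-1|}`. -/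
def deviation (a b c : ℓ^∞(ℤ, ℂ)) (k : ℤ) : ℝ :=
  max ‖a (k - 1) - 1‖ (max ‖a k - 1‖ (max ‖b k‖ (max ‖c (k - 1) - 1‖ ‖c k - 1‖)))

/-- The algebraic multiplicity of `z`: the dimension of `⋃ₘ ker (T - z)ᵐ`
(`0` if this is infinite). For an isolated point `z` of the spectrum at which `T - z` is Fredholm, as
for every point of `σ(T) \ [-2,2]` when `T` is a compact perturbation of the free Jacobi operator,
this is the rank of the Riesz projection. -/
def algMult (T : ℓ^2(ℤ, ℂ) →L[ℂ] ℓ^2(ℤ, ℂ)) (z : ℂ) : ℕ :=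
  Module.finrank ℂ (Module.End.maxGenEigenspace (T : ℓ^2(ℤ, ℂ) →ₗ[ℂ] ℓ^2(ℤ, ℂ)) z)

/-- The discrete spectrum: the eigenvalues that are isolated points of the spectrum and have
finite algebraic multiplicity. -/
def discreteSpectrum (T : ℓ^2(ℤ, ℂ) →L[ℂ] ℓ^2(ℤ, ℂ)) : Set ℂ :=
  {z | Module.End.HasEigenvalue (T : ℓ^2(ℤ, ℂ) →ₗ[ℂ] ℓ^2(ℤ, ℂ)) z ∧
    (∀ᶠ w in 𝓝[≠] z, w ∉ spectrum ℂ T) ∧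
    FiniteDimensional ℂ
      (Module.End.maxGenEigenspace (T : ℓ^2(ℤ, ℂ) →ₗ[ℂ] ℓ^2(ℤ, ℂ)) z)}

/-- `dist(z, [-2,2])`. -/
def distInterval (z : ℂ) : ℝ := Metric.infDist z (Complex.ofReal '' Set.Icc (-2) 2)

/-- `dist(z, {-2,2})`. -/
def distEndpoints (z : ℂ) : ℝ := Metric.infDist z {-2, 2}

/-- The summand
`dist(z,[-2,2])^p / |z² - 4|^{1/2} * f (-log (dist(z,[-2,2]) / dist(z,{-2,2})))`. -/
def weight (p : ℝ) (f : ℝ → ℝ) (z : ℂ) : ℝ :=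
  distInterval z ^ p / ‖z ^ 2 - 4‖ ^ (1 / 2 : ℝ) *
    f (-Real.log (distInterval z / distEndpoints z))

/-- The sum of the weights over the discrete spectrum, with each eigenvalue repeated according to
its algebraic multiplicity; a sum of nonnegative terms with values in `[0, ∞]`. -/
def eigenvalueSum (p : ℝ) (f : ℝ → ℝ) (T : ℓ^2(ℤ, ℂ) →L[ℂ] ℓ^2(ℤ, ℂ)) : ℝ≥0∞ :=
  ∑' z : discreteSpectrum T, (algMult T z : ℝ≥0∞) * ENNReal.ofReal (weight p f z)

/-- The eigenvalue sum of the Jacobi operator divided by `‖v‖_{ℓ^p}^p`. -/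
def ratio (p : ℝ) (f : ℝ → ℝ) (a b c : ℓ^∞(ℤ, ℂ)) : ℝ≥0∞ :=
  eigenvalueSum p f (jacobi a b c) / ∑' k : ℤ, ENNReal.ofReal (deviation a b c k ^ p)

/-- The supremum of the ratio over all Jacobi operators with `0 ≠ v ∈ ℓ^p(ℤ)`. -/
def supRatio (p : ℝ) (f : ℝ → ℝ) : ℝ≥0∞ :=
  ⨆ (a : ℓ^∞(ℤ, ℂ)) (b : ℓ^∞(ℤ, ℂ)) (c : ℓ^∞(ℤ, ℂ)) (_ : deviation a b c ≠ 0)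
    (_ : Memℓp (deviation a b c) (ENNReal.ofReal p)), ratio p f a b c

/-- The values of the box potential: `b_k = i n^{-2/3}` for `1 ≤ k ≤ n`, and `0` otherwise. -/
def boxValue (n : ℕ) (k : ℤ) : ℂ :=
  if 1 ≤ k ∧ k ≤ n then Complex.I * (((n : ℝ) ^ (-2 / 3 : ℝ) : ℝ) : ℂ) else 0

theorem memℓp_boxValue (n : ℕ) : Memℓp (boxValue n) ∞ := by
  refine memℓp_infty ⟨(n : ℝ) ^ (-2 / 3 : ℝ), ?_⟩
  rintro _ ⟨k, rfl⟩
  have h : (0 : ℝ) ≤ (n : ℝ) ^ (-2 / 3 : ℝ) := by positivity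
  simp only [boxValue]
  split_ifs
  · rw [norm_mul, Complex.norm_I, one_mul, Complex.norm_real, Real.norm_of_nonneg h]
  · simpa using h

/-- The box potential as a bounded sequence. -/
def box (n : ℕ) : ℓ^∞(ℤ, ℂ) := ⟨boxValue n, memℓp_boxValue n⟩

/-- `F(x) = ∫_0^x f(t) dt`. -/
def primitive (f : ℝ → ℝ) (x : ℝ) : ℝ := ∫ t in (0 : ℝ)..x, f t

end JacobiLT

end

/-!
Write `a = n^{1/3}`, so that the box potential has height `h = i / a²`. Inside the box an
eigenvector of `J_n` is a combination of the plane waves `w^{±k}`, `w = exp (-i θ)`, even or odd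
under reflection of the box, and outside it decays geometrically with ratio `κ`, `|κ| < 1`; the
eigenvalue is `2 cos θ + h = κ + κ⁻¹`. In terms of the reflection coefficient `r = (w - κ) / (1 -
κ w)` the matching condition is `r wⁿ = ±1`, and the relation between `θ` and `r` is `-4 sin² θ ·
r = h (1 - 2 cos θ · r + r²)`. With `τ = π (m + 1/2) / n` and `θ = τ + i (log (4 a² τ²) + s) / n`
the matching condition holds for a suitable explicit `r`, and the relation becomes a fixed-point
equation for `s`, whose right-hand side is small and holomorphic on the unit disc as soon as `a τ`
is large and `τ` is small. Thus every such `m` yields an eigenvalue (`exists_eigenvalue`) near `2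
cos τ + i / a²`, and these are distinct.

These eigenvalues lie in the open upper half-plane, and there every eigenvalue is discrete
(`mem_discreteSpectrum_jacobi_box`). The spectrum of `J_n` in the half-plane consists of
eigenvalues by the Fredholm alternative. Moreover the imaginary part of `J_n` is a nonnegative
operator of trace `n / a²`; comparing traces on finite-dimensional invariant subspaces
(`ImTraceLE`) bounds the dimension of each generalized eigenspace and the number of eigenvalues
with `Im z ≥ δ > 0`.

The distance of the `m`-th eigenvalue to `[-2, 2]` is comparable to `a⁻²`, its distance to `{-2,
2}` is at least `τ² / 2`, and `|λ² - 4|^{1/2} ≤ 4 τ`. Hence its weight is at least a constant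
times `a^{-2p} f(2 log (a τ / 2)) / τ`, and since `f` is monotone the sum over `m` dominates the
corresponding integral in the logarithmic variable, which is a difference of values of `F`
(`primitive_sub_le_sum`). Replacing `a τ` by `a τ / 2` in the argument of `f` costs nothing, as
the range of `m` can be shifted by the same factor.
-/

namespace JacobiLT

/-! ### Operators whose imaginary part has finite trace -/

section ImTrace

variable {H : Type*} [NormedAddCommGroup H] [InnerProductSpace ℂ H]

/-- The trace of the imaginary part of `T` is at most `c`: for every finite orthonormal family `e`,
the numbers `Im ⟨e i, T (e i)⟩` sum to at most `c`. -/
def ImTraceLE (T : Module.End ℂ H) (c : ℝ) : Prop :=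
  ∀ (N : ℕ) (e : Fin N → H), Orthonormal ℂ e → ∑ i, (inner ℂ (e i) (T (e i))).im ≤ c

theorem ImTraceLE.im_trace_restrict_le {T : Module.End ℂ H} {c : ℝ} (hT : ImTraceLE T c)
    (W : Submodule ℂ H) [FiniteDimensional ℂ W] (hW : ∀ x ∈ W, T x ∈ W) :
    (LinearMap.trace ℂ W (T.restrict hW)).im ≤ c := by
  have b := stdOrthonormalBasis ℂ W
  rw [LinearMap.trace_eq_sum_inner _ b, Complex.im_sum]
  refine le_trans (le_of_eq ?_) (hT _ (fun i => (b i : H)) ?_)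
  · rfl
  · exact b.orthonormal.comp_linearIsometry W.subtypeₗᵢ

/-- If `T - z` is nilpotent on the invariant subspace `W`, the trace of `T` on `W` is
`z * dim W`. -/
theorem ImTraceLE.finrank_mul_im_le {T : Module.End ℂ H} {c : ℝ} (hT : ImTraceLE T c) {z : ℂ}
    (W : Submodule ℂ H) [FiniteDimensional ℂ W] (hW : ∀ x ∈ W, (T - z • 1) x ∈ W) {k : ℕ}
    (hk : ∀ x ∈ W, ((T - z • 1) ^ k) x = 0) : Module.finrank ℂ W * z.im ≤ c := by
  have hTW : ∀ x ∈ W, T x ∈ W := fun x hx => by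
    have := W.add_mem (hW x hx) (W.smul_mem z hx)
    simpa using this
  have hnil : IsNilpotent ((T - z • 1).restrict hW) := by
    refine ⟨k, LinearMap.ext fun x => Subtype.ext ?_⟩
    rw [Module.End.pow_restrict]
    exact hk x x.2
  have h0 : LinearMap.trace ℂ W ((T - z • 1).restrict hW) = 0 :=
    (LinearMap.isNilpotent_trace_of_isNilpotent hnil).eq_zero
  have hdec : T.restrict hTW = (T - z • 1).restrict hW + z • 1 := by
    ext x
    simp
  have h := hT.im_trace_restrict_le W hTW
  rw [hdec, map_add, h0, map_smul, LinearMap.trace_one] at h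
  simpa [mul_comm] using h

/-- Finitely many generalized eigenvectors span, together with their images under powers of `T - z`,
a finite-dimensional invariant subspace, whose dimension the trace bound controls uniformly. -/
theorem ImTraceLE.finiteDimensional_maxGenEigenspace {T : Module.End ℂ H} {c : ℝ}
    (hT : ImTraceLE T c) {z : ℂ} (hz : 0 < z.im) :
    FiniteDimensional ℂ (Module.End.maxGenEigenspace T z) := by
  rw [FiniteDimensional, ← Module.rank_lt_aleph0_iff]
  by_contra hinf
  obtain ⟨M, hM⟩ := exists_nat_gt (c / z.im)
  have hle : (M : Cardinal) ≤ Module.rank ℂ (Module.End.maxGenEigenspace T z) :=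
    (Cardinal.natCast_le_aleph0).trans (not_lt.1 hinf)
  obtain ⟨s, hs, hli⟩ := le_rank_iff_exists_linearIndependent_finset.1 hle
  have hex : ∀ x : Module.End.maxGenEigenspace T z, ∃ k : ℕ, ((T - z • 1) ^ k) (x : H) = 0 :=
    fun x => (Module.End.mem_maxGenEigenspace T z x).1 x.2
  choose κ hκ using hex
  let K := s.sup κ
  have hK : ∀ x ∈ s, ((T - z • 1) ^ K) (x : H) = 0 := fun x hx => by
    obtain ⟨d, hd⟩ := Nat.exists_eq_add_of_le (Finset.le_sup (f := κ) hx)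
    change ((T - z • 1) ^ (s.sup κ)) (x : H) = 0
    rw [hd, add_comm, pow_add, Module.End.mul_apply, hκ, map_zero]
  -- The vectors `(T - z)ⁱ x` with `x ∈ s`, `i < K` span a finite-dimensional invariant subspace.
  let S : Set H := Set.range fun q : s × Fin K => ((T - z • 1) ^ (q.2 : ℕ)) (q.1 : H)
  let W := Submodule.span ℂ S
  have : FiniteDimensional ℂ W := FiniteDimensional.span_of_finite ℂ (Set.finite_range _)
  have hS : ∀ (i : ℕ) (x : s), ((T - z • 1) ^ i) (x : H) ∈ W := fun i x => by
    by_cases hi : i < K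
    · exact Submodule.subset_span ⟨(x, ⟨i, hi⟩), rfl⟩
    · obtain ⟨d, rfl⟩ := Nat.exists_eq_add_of_le (not_lt.1 hi)
      rw [add_comm, pow_add, Module.End.mul_apply, hK _ x.2, map_zero]
      exact W.zero_mem
  have hW : ∀ x ∈ W, (T - z • 1) x ∈ W := by
    intro x hx
    refine Submodule.span_induction (p := fun y _ => (T - z • 1) y ∈ W) ?_ ?_ ?_ ?_ hx
    · rintro _ ⟨q, rfl⟩
      have := hS (q.2 + 1) q.1
      rwa [pow_succ', Module.End.mul_apply] at this
    · simp
    · intro u v _ _ hu hv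
      rw [map_add]
      exact W.add_mem hu hv
    · intro a u _ hu
      rw [map_smul]
      exact W.smul_mem a hu
  have hk : ∀ x ∈ W, ((T - z • 1) ^ K) x = 0 := by
    intro x hx
    refine Submodule.span_induction (p := fun y _ => ((T - z • 1) ^ K) y = 0) ?_ ?_ ?_ ?_ hx
    · rintro _ ⟨q, rfl⟩
      simp only
      rw [← Module.End.mul_apply, ← pow_add, add_comm, pow_add, Module.End.mul_apply,
        hK _ q.1.2, map_zero]
    · simp
    · intro u v _ _ hu hv
      rw [map_add, hu, hv, add_zero]
    · intro a u _ hu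
      rw [map_smul, hu, smul_zero]
  have hdim := hT.finrank_mul_im_le W hW hk
  have hli' : LinearIndependent ℂ (fun x : s => (⟨((x : Module.End.maxGenEigenspace T z) : H),
      by simpa using hS 0 x⟩ : W)) := by
    refine LinearIndependent.of_comp W.subtype ?_
    exact hli.map' (Submodule.subtype _) (Submodule.ker_subtype _)
  have hcard : M ≤ Module.finrank ℂ W := by
    have := hli'.fintype_card_le_finrank
    simpa [hs] using this
  have : (M : ℝ) * z.im ≤ c :=
    le_trans (mul_le_mul_of_nonneg_right (by exact_mod_cast hcard) hz.le) hdim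
  rw [div_lt_iff₀ hz] at hM
  linarith

/-- On the span of eigenvectors of distinct eigenvalues `z i`, the trace of `T` is `∑ z i`. -/
theorem ImTraceLE.finite_eigenvalues {T : Module.End ℂ H} {c : ℝ} (hT : ImTraceLE T c) {δ : ℝ}
    (hδ : 0 < δ) : {z : ℂ | T.HasEigenvalue z ∧ δ ≤ z.im}.Finite := by
  by_contra hinf
  obtain ⟨M, hM⟩ := exists_nat_gt (c / δ)
  obtain ⟨t, ht, hcard⟩ := Set.Infinite.exists_subset_card_eq hinf M
  have hev : ∀ i : t, ∃ v : H, T.HasEigenvector (i : ℂ) v := fun i =>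
    (ht i.2).1.exists_hasEigenvector
  choose v hv using hev
  have hli : LinearIndependent ℂ v :=
    Module.End.eigenvectors_linearIndependent' T (fun i : t => (i : ℂ)) Subtype.val_injective v hv
  let W := Submodule.span ℂ (Set.range v)
  let b : Module.Basis t ℂ W := Module.Basis.span hli
  have : FiniteDimensional ℂ W := FiniteDimensional.span_of_finite ℂ (Set.finite_range _)
  have hbv : ∀ i, (b i : H) = v i := fun i =>
    congrArg Subtype.val (Module.Basis.span_apply hli i)
  have hW : ∀ x ∈ W, T x ∈ W := by
    intro x hx
    refine Submodule.span_induction (p := fun y _ => T y ∈ W) ?_ ?_ ?_ ?_ hx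
    · rintro _ ⟨i, rfl⟩
      rw [(hv i).apply_eq_smul]
      exact W.smul_mem _ (Submodule.subset_span ⟨i, rfl⟩)
    · simp
    · intro u v _ _ hu hv
      rw [map_add]
      exact W.add_mem hu hv
    · intro a u _ hu
      rw [map_smul]
      exact W.smul_mem a hu
  have hTb : ∀ i, (T.restrict hW) (b i) = (i : ℂ) • b i := fun i => Subtype.ext (by
    rw [LinearMap.coe_restrict_apply, hbv, (hv i).apply_eq_smul, Submodule.coe_smul, hbv])
  have htr : LinearMap.trace ℂ W (T.restrict hW) = ∑ i : t, (i : ℂ) := by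
    rw [LinearMap.trace_eq_matrix_trace ℂ b, Matrix.trace]
    refine Finset.sum_congr rfl fun i _ => ?_
    rw [Matrix.diag_apply, LinearMap.toMatrix_apply, hTb]
    simp
  have h := hT.im_trace_restrict_le W hW
  rw [htr, Complex.im_sum] at h
  have h2 : (M : ℝ) * δ ≤ ∑ i : t, (i : ℂ).im := by
    have := Finset.card_nsmul_le_sum Finset.univ (fun i : t => (i : ℂ).im) δ
      (fun i _ => (ht i.2).2)
    simpa [hcard] using this
  rw [div_lt_iff₀ hδ] at hM
  linarith

end ImTrace

/-! ### Discrete spectrum of the box Jacobi operator in the upper half-plane -/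

theorem inner_shiftOp_left (s : ℤ) (u v : ℓ^2(ℤ, ℂ)) :
    inner ℂ (shiftOp s u) v = inner ℂ u (shiftOp (-s) v) := by
  rw [lp.inner_eq_tsum, lp.inner_eq_tsum, ← (Equiv.addRight s).tsum_eq
    (fun k => inner ℂ (u k) (shiftOp (-s) v k))]
  refine tsum_congr fun k => ?_
  simp [shiftOp_apply]

theorem mulOp_one : mulOp 1 = 1 := by
  ext u k
  simp [mulOp_apply]

theorem mulOp_zero : mulOp 0 = 0 := by
  ext u k
  simp [mulOp_apply]

theorem jacobi_one_one (b : ℓ^∞(ℤ, ℂ)) : jacobi 1 b 1 = jacobi 1 0 1 + mulOp b := by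
  simp only [jacobi, mulOp_zero]
  abel

theorem isSelfAdjoint_jacobi_free : IsSelfAdjoint (jacobi 1 0 1) := by
  rw [ContinuousLinearMap.isSelfAdjoint_iff_isSymmetric]
  intro u v
  simp only [jacobi, mulOp_zero, mulOp_one, add_zero, ContinuousLinearMap.coe_coe,
    add_apply, inner_add_left, inner_add_right,
    ContinuousLinearMap.comp_apply, one_apply_eq_self, inner_shiftOp_left, neg_neg]
  rw [add_comm]

theorem boxValue_of_mem {n : ℕ} {k : ℤ} (hk : k ∈ Finset.Icc (1 : ℤ) n) :
    boxValue n k = Complex.I * (((n : ℝ) ^ (-2 / 3 : ℝ) : ℝ) : ℂ) :=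
  if_pos (Finset.mem_Icc.1 hk)

theorem boxValue_of_notMem {n : ℕ} {k : ℤ} (hk : k ∉ Finset.Icc (1 : ℤ) n) :
    boxValue n k = 0 :=
  if_neg fun h => hk (Finset.mem_Icc.2 h)

theorem box_apply (n : ℕ) (k : ℤ) : box n k = boxValue n k := rfl

theorem im_inner_jacobi_box (n : ℕ) (u : ℓ^2(ℤ, ℂ)) :
    (inner ℂ u (jacobi 1 (box n) 1 u)).im =
      (n : ℝ) ^ (-2 / 3 : ℝ) * ∑ k ∈ Finset.Icc (1 : ℤ) n, ‖u k‖ ^ 2 := by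
  have h0 : (inner ℂ u (jacobi 1 0 1 u)).im = 0 :=
    (ContinuousLinearMap.isSelfAdjoint_iff_isSymmetric.1
      isSelfAdjoint_jacobi_free).im_inner_self_apply u
  rw [jacobi_one_one, add_apply, inner_add_right, Complex.add_im, h0, zero_add,
    lp.inner_eq_tsum, tsum_eq_sum (s := Finset.Icc (1 : ℤ) n), Complex.im_sum, Finset.mul_sum]
  · refine Finset.sum_congr rfl fun k hk => ?_
    have : inner ℂ (u k) (mulOp (box n) u k) =
        (((n : ℝ) ^ (-2 / 3 : ℝ) * ‖u k‖ ^ 2 : ℝ) : ℂ) * Complex.I := by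
      rw [mulOp_apply, box_apply, boxValue_of_mem hk]
      push_cast
      rw [RCLike.inner_apply, mul_right_comm, mul_assoc, mul_assoc, Complex.conj_mul']
      ring
    rw [this, Complex.mul_I_im, Complex.ofReal_re]
  · intro k hk
    rw [mulOp_apply, box_apply, boxValue_of_notMem hk]
    simp

/-- The free operator is self-adjoint, and the box has imaginary part of trace `n * n^{-2/3}`: by
Bessel's inequality each of its `n` sites contributes at most `n^{-2/3}`. -/
theorem imTraceLE_jacobi_box (n : ℕ) :
    ImTraceLE (jacobi 1 (box n) 1 : ℓ^2(ℤ, ℂ) →ₗ[ℂ] ℓ^2(ℤ, ℂ))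
      ((n : ℝ) ^ (-2 / 3 : ℝ) * n) := by
  intro N e he
  simp only [ContinuousLinearMap.coe_coe, im_inner_jacobi_box]
  rw [← Finset.mul_sum, Finset.sum_comm]
  have hk : ∀ k ∈ Finset.Icc (1 : ℤ) n, ∑ i, ‖e i k‖ ^ 2 ≤ 1 := by
    intro k _
    have h := he.sum_inner_products_le (lp.single 2 k (1 : ℂ) : ℓ^2(ℤ, ℂ)) (s := Finset.univ)
    have hi : ∀ i, ‖inner ℂ (e i) (lp.single 2 k (1 : ℂ) : ℓ^2(ℤ, ℂ))‖ = ‖e i k‖ := fun i => by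
      rw [norm_inner_symm, lp.inner_single_left]
      simp
    rw [lp.norm_single (by norm_num)] at h
    simpa only [hi, norm_one, one_pow] using h
  have := Finset.sum_le_sum hk
  have h2 : ∑ k ∈ Finset.Icc (1 : ℤ) n, ∑ i, ‖e i k‖ ^ 2 ≤ n := by
    simpa using this
  gcongr

theorem isCompactOperator_mulOp_box (n : ℕ) : IsCompactOperator (mulOp (box n)) := by
  classical
  let V : Submodule ℂ ℓ^2(ℤ, ℂ) :=
    Submodule.span ℂ ((fun k : ℤ => (lp.single 2 k (1 : ℂ) : ℓ^2(ℤ, ℂ))) '' Finset.Icc (1 : ℤ) n)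
  have : FiniteDimensional ℂ V :=
    FiniteDimensional.span_of_finite ℂ ((Finset.finite_toSet _).image _)
  have hV : ∀ u, mulOp (box n) u ∈ V := by
    intro u
    have : mulOp (box n) u = ∑ k ∈ Finset.Icc (1 : ℤ) n,
        (boxValue n k * u k) • (lp.single 2 k (1 : ℂ) : ℓ^2(ℤ, ℂ)) := by
      ext j
      rw [mulOp_apply, box_apply, lp.coeFn_sum, Finset.sum_apply]
      simp only [lp.coeFn_smul, Pi.smul_apply, lp.coeFn_single, smul_eq_mul]
      by_cases hj : j ∈ Finset.Icc (1 : ℤ) n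
      · rw [Finset.sum_eq_single_of_mem j hj]
        · simp
        · intro k _ hk
          simp [hk.symm]
      · rw [boxValue_of_notMem hj, zero_mul]
        refine (Finset.sum_eq_zero fun k hk => ?_).symm
        have : j ≠ k := fun h => hj (h ▸ hk)
        simp [this]
    rw [this]
    exact V.sum_mem fun k hk => V.smul_mem _ (Submodule.subset_span ⟨k, hk, rfl⟩)
  have : ProperSpace V := FiniteDimensional.proper ℂ V
  let S : ℓ^2(ℤ, ℂ) →L[ℂ] V := (mulOp (box n)).codRestrict V hV
  have hc : IsCompactOperator S := isCompactOperator_of_locallyCompactSpace_dom S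
  exact hc.clm_comp V.subtypeL

/-- Analytic Fredholm theory reduces here to the Fredholm alternative: off the spectrum of the free
operator `J₀`, `J - z = (J₀ - z) (1 + (J₀ - z)⁻¹ B)` with `B` of finite rank. -/
theorem hasEigenvalue_of_mem_spectrum_jacobi_box {n : ℕ} {z : ℂ} (hz : 0 < z.im)
    (hs : z ∈ spectrum ℂ (jacobi 1 (box n) 1)) :
    Module.End.HasEigenvalue (jacobi 1 (box n) 1 : ℓ^2(ℤ, ℂ) →ₗ[ℂ] ℓ^2(ℤ, ℂ)) z := by
  have hz0 : z ∉ spectrum ℂ (jacobi 1 0 1) := fun h => by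
    have h1 := isSelfAdjoint_jacobi_free.mem_spectrum_eq_re h
    rw [h1] at hz
    simp at hz
  rw [spectrum.notMem_iff] at hz0
  obtain ⟨U, hU⟩ := hz0
  set B := mulOp (box n)
  set R : ℓ^2(ℤ, ℂ) →L[ℂ] ℓ^2(ℤ, ℂ) := ↑U⁻¹
  have hK : IsCompactOperator (R * B) := (isCompactOperator_mulOp_box n).clm_comp R
  have hUR : (U : ℓ^2(ℤ, ℂ) →L[ℂ] ℓ^2(ℤ, ℂ)) * R = 1 := U.mul_inv
  have hJ : algebraMap ℂ _ z - jacobi 1 (box n) 1 = U * (1 - R * B) := by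
    rw [mul_sub, ← mul_assoc, hUR, mul_one, one_mul, hU, jacobi_one_one]
    abel
  rcases hK.hasEigenvalue_or_mem_resolventSet one_ne_zero with h | h
  · obtain ⟨v, hv⟩ := h.exists_hasEigenvector
    refine Module.End.hasEigenvalue_of_hasEigenvector (x := v)
      ⟨Module.End.mem_eigenspace_iff.2 ?_, hv.2⟩
    have h1 : (R * B) v = v := by simpa using hv.apply_eq_smul
    have h2 := congrArg (fun S : ℓ^2(ℤ, ℂ) →L[ℂ] ℓ^2(ℤ, ℂ) => S v) hJ
    simp only [mul_apply_eq_comp, sub_apply, one_apply_eq_self] at h1 h2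
    rw [h1, sub_self, map_zero, sub_eq_zero] at h2
    rw [ContinuousLinearMap.coe_coe, ← h2, Algebra.algebraMap_eq_smul_one]
    rfl
  · refine absurd hs (spectrum.notMem_iff.2 ?_)
    rw [hJ]
    refine U.isUnit.mul ?_
    simpa [spectrum.mem_resolventSet_iff] using h

/-- Isolatedness holds since near `z` the spectrum consists of eigenvalues with imaginary part above
`Im z / 2`, of which there are finitely many. -/
theorem mem_discreteSpectrum_jacobi_box {n : ℕ} {z : ℂ} (hz : 0 < z.im)
    (he : Module.End.HasEigenvalue (jacobi 1 (box n) 1 : ℓ^2(ℤ, ℂ) →ₗ[ℂ] ℓ^2(ℤ, ℂ)) z) :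
    z ∈ discreteSpectrum (jacobi 1 (box n) 1) := by
  refine ⟨he, ?_, (imTraceLE_jacobi_box n).finiteDimensional_maxGenEigenspace hz⟩
  have hfin := (imTraceLE_jacobi_box n).finite_eigenvalues (half_pos hz)
  have h1 : ∀ᶠ w in 𝓝[≠] z, w ∉ {w : ℂ | Module.End.HasEigenvalue
      (jacobi 1 (box n) 1 : ℓ^2(ℤ, ℂ) →ₗ[ℂ] ℓ^2(ℤ, ℂ)) w ∧ z.im / 2 ≤ w.im} := by
    have := (hfin.sdiff (t := {z})).isClosed.isOpen_compl.mem_nhds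
      (x := z) (by simp)
    filter_upwards [nhdsWithin_le_nhds this, self_mem_nhdsWithin] with w hw hne h
    exact hw ⟨h, hne⟩
  have h2 : ∀ᶠ w in 𝓝[≠] z, z.im / 2 < w.im :=
    nhdsWithin_le_nhds (Complex.continuous_im.continuousAt.eventually
      (lt_mem_nhds (half_lt_self hz)))
  filter_upwards [h1, h2] with w hw1 hw2 hs
  exact hw1 ⟨hasEigenvalue_of_mem_spectrum_jacobi_box ((half_pos hz).trans hw2) hs, hw2.le⟩

theorem one_le_algMult {T : ℓ^2(ℤ, ℂ) →L[ℂ] ℓ^2(ℤ, ℂ)} {z : ℂ} (hz : z ∈ discreteSpectrum T) :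
    1 ≤ algMult T z := by
  obtain ⟨he, -, hfin⟩ := hz
  obtain ⟨v, hv⟩ := he.exists_hasEigenvector
  have hmem := Module.End.eigenspace_le_maxGenEigenspace (μ := z) hv.1
  have : Nontrivial (Module.End.maxGenEigenspace (T : ℓ^2(ℤ, ℂ) →ₗ[ℂ] ℓ^2(ℤ, ℂ)) z) :=
    ⟨⟨v, hmem⟩, 0, fun h => hv.2 (congrArg Subtype.val h)⟩
  exact Module.finrank_pos

/-! ### Explicit eigenvectors -/

/-- The plane-wave solution `wᵏ + ρ wⁿ⁺¹⁻ᵏ` inside the box; for `ρ = ±1` it is even or odd under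
the reflection `k ↦ n + 1 - k`. -/
noncomputable def innerSolution (n : ℕ) (w ρ : ℂ) (k : ℤ) : ℂ := w ^ k + ρ * w ^ (n + 1 - k)

/-- The inner solution on `0, …, n + 1`, continued by geometric decay with ratio `κ` on both
sides. -/
noncomputable def eigenSequence (n : ℕ) (w κ ρ : ℂ) (k : ℤ) : ℂ :=
  if k ≤ 0 then κ ^ (-k) * innerSolution n w ρ 0
  else if k ≤ n then innerSolution n w ρ k
  else κ ^ (k - (n + 1)) * innerSolution n w ρ (n + 1)

section

variable {n : ℕ} {w κ ρ : ℂ}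

theorem innerSolution_recurrence (hw : w ≠ 0) (k : ℤ) :
    innerSolution n w ρ (k - 1) + innerSolution n w ρ (k + 1) =
      (w + w⁻¹) * innerSolution n w ρ k := by
  have e1 : w ^ ((n : ℤ) + 1 - (k - 1)) = w ^ ((n : ℤ) + 1 - k) * w := by
    rw [← zpow_add_one₀ hw]
    ring_nf
  have e2 : w ^ ((n : ℤ) + 1 - (k + 1)) = w ^ ((n : ℤ) + 1 - k) * w⁻¹ := by
    rw [← zpow_sub_one₀ hw]
    ring_nf
  simp only [innerSolution, e1, e2, zpow_sub_one₀ hw, zpow_add_one₀ hw]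
  ring

theorem innerSolution_reflect (hρ : ρ ^ 2 = 1) (k : ℤ) :
    innerSolution n w ρ (n + 1 - k) = ρ * innerSolution n w ρ k := by
  simp only [innerSolution, sub_sub_cancel]
  linear_combination -(w ^ ((n : ℤ) + 1 - k)) * hρ

theorem eigenSequence_of_nonpos {k : ℤ} (hk : k ≤ 0) :
    eigenSequence n w κ ρ k = κ ^ (-k) * innerSolution n w ρ 0 := if_pos hk

theorem eigenSequence_of_mem {k : ℤ} (hk : 0 ≤ k) (hkn : k ≤ n + 1) :
    eigenSequence n w κ ρ k = innerSolution n w ρ k := by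
  unfold eigenSequence
  split_ifs with h1 h2
  · obtain rfl : k = 0 := le_antisymm h1 hk
    simp
  · rfl
  · obtain rfl : k = n + 1 := by omega
    simp

theorem eigenSequence_of_gt {k : ℤ} (hk : (n : ℤ) + 1 ≤ k) :
    eigenSequence n w κ ρ k = κ ^ (k - (n + 1)) * innerSolution n w ρ (n + 1) := by
  unfold eigenSequence
  rw [if_neg (by omega), if_neg (by omega)]

theorem memℓp_eigenSequence (hκ : ‖κ‖ < 1) : Memℓp (eigenSequence n w κ ρ) 2 := by
  have hgeo : ∀ c : ℂ, Summable fun j : ℕ => ‖κ ^ (j : ℤ) * c‖ ^ (2 : ℝ≥0∞).toReal := fun c => by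
    have h : Summable fun j : ℕ => (‖κ‖ ^ 2) ^ j * ‖c‖ ^ 2 :=
      (summable_geometric_of_lt_one (by positivity) (by
        rw [sq_lt_one_iff₀ (norm_nonneg _)]
        exact hκ)).mul_right _
    refine h.congr fun j => ?_
    simp only [ENNReal.toReal_ofNat, Real.rpow_ofNat, norm_mul, zpow_natCast, norm_pow, mul_pow]
    rw [← pow_mul, ← pow_mul, mul_comm 2 j]
  refine memℓp_gen (summable_int_iff_summable_nat_and_neg.2 ⟨?_, ?_⟩)
  · rw [← summable_nat_add_iff (n + 1)]
    refine (hgeo (innerSolution n w ρ (n + 1))).congr fun j => ?_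
    rw [eigenSequence_of_gt (by push_cast; omega)]
    push_cast
    rw [add_sub_cancel_right]
  · refine (hgeo (innerSolution n w ρ 0)).congr fun j => ?_
    rw [eigenSequence_of_nonpos (by omega), neg_neg]

/-- The matching condition at the left edge of the box implies the one at the right edge, by
reflection, and then the continued sequence is an eigenvector. -/
theorem hasEigenvalue_jacobi_box (hw : w ≠ 0) (hw2 : w ^ 2 ≠ 1) (hκ0 : κ ≠ 0) (hκ : ‖κ‖ < 1)
    (hρ : ρ ^ 2 = 1) (hz : κ + κ⁻¹ = w + w⁻¹ + Complex.I * (((n : ℝ) ^ (-2 / 3 : ℝ) : ℝ) : ℂ))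
    (hedge : 1 + ρ * w ^ (n + 1) = κ * (w + ρ * w ^ n)) :
    Module.End.HasEigenvalue (jacobi 1 (box n) 1 : ℓ^2(ℤ, ℂ) →ₗ[ℂ] ℓ^2(ℤ, ℂ)) (κ + κ⁻¹) := by
  have hleft : innerSolution n w ρ 0 = κ * innerSolution n w ρ 1 := by
    simp only [innerSolution, zpow_zero, zpow_one, sub_zero, add_sub_cancel_right, zpow_natCast]
    rw [← hedge]
    norm_cast
  have hright : innerSolution n w ρ (n + 1) = κ * innerSolution n w ρ n := by
    have h0 := innerSolution_reflect (n := n) (w := w) hρ 0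
    have h1 := innerSolution_reflect (n := n) (w := w) hρ 1
    rw [sub_zero] at h0
    rw [add_sub_cancel_right] at h1
    rw [h0, h1, hleft]
    ring
  set u : ℓ^2(ℤ, ℂ) := ⟨eigenSequence n w κ ρ, memℓp_eigenSequence hκ⟩
  have hu : ∀ k, u k = eigenSequence n w κ ρ k := fun _ => rfl
  refine Module.End.hasEigenvalue_of_hasEigenvector (x := u)
    ⟨Module.End.mem_eigenspace_iff.2 ?_, fun h0 => ?_⟩
  · ext k
    rw [ContinuousLinearMap.coe_coe, jacobi_apply, box_apply, lp.coeFn_smul, Pi.smul_apply,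
      smul_eq_mul]
    simp only [hu, lp.infty_coeFn_one, Pi.one_apply, one_mul]
    rcases lt_trichotomy k 0 with hk | rfl | hk
    · rw [boxValue_of_notMem (by simp; omega), eigenSequence_of_nonpos (by omega),
        eigenSequence_of_nonpos (by omega), eigenSequence_of_nonpos (by omega),
        show -(k - 1) = -k + 1 by ring, show -(k + 1) = -k - 1 by ring, zpow_add_one₀ hκ0,
        zpow_sub_one₀ hκ0]
      ring
    · rw [boxValue_of_notMem (by simp), eigenSequence_of_nonpos (by omega),
        eigenSequence_of_nonpos le_rfl, eigenSequence_of_mem (by omega) (by omega), zero_add,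
        hleft]
      field_simp
      simp only [zero_sub, neg_neg, zpow_one, neg_zero, zpow_zero, zero_mul, add_zero]
      ring
    rcases lt_trichotomy k (n + 1) with hkn | rfl | hkn
    · rw [boxValue_of_mem (by simp; omega), eigenSequence_of_mem (by omega) (by omega),
        eigenSequence_of_mem (by omega) (by omega), eigenSequence_of_mem (by omega) (by omega), hz]
      linear_combination innerSolution_recurrence (n := n) (ρ := ρ) hw k
    · rw [boxValue_of_notMem (by simp), eigenSequence_of_mem (by omega) (by omega),
        eigenSequence_of_gt le_rfl, eigenSequence_of_gt (by omega), add_sub_cancel_right, hright]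
      simp only [sub_self, zpow_zero, add_sub_cancel_left, zpow_one]
      field_simp
      ring
    · rw [boxValue_of_notMem (by simp; omega), eigenSequence_of_gt (by omega),
        eigenSequence_of_gt (by omega), eigenSequence_of_gt (by omega),
        show k + 1 - ((n : ℤ) + 1) = k - (n + 1) + 1 by ring,
        show k - 1 - ((n : ℤ) + 1) = k - (n + 1) - 1 by ring, zpow_add_one₀ hκ0,
        zpow_sub_one₀ hκ0]
      ring
  · have hu0 : innerSolution n w ρ 0 = 0 := by
      rw [← eigenSequence_of_mem (κ := κ) le_rfl (by omega), ← hu, h0]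
      rfl
    have hu1 : innerSolution n w ρ 1 = 0 := by
      rw [← eigenSequence_of_mem (κ := κ) (by omega) (by omega), ← hu, h0]
      rfl
    -- Vanishing at two neighbours forces `w² = 1`.
    refine hw2 ?_
    have e : w ^ ((n : ℤ) + 1) = w ^ (n : ℤ) * w := zpow_add_one₀ hw _
    simp only [innerSolution, zpow_zero, zpow_one, sub_zero, add_sub_cancel_right, e] at hu0 hu1
    linear_combination w * hu1 - hu0

end

/-! ### Solving the quantization condition -/

/-- A holomorphic self-map of the unit disc with small sup norm is a contraction on the half-disc,
by Cauchy's estimate. -/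
theorem exists_fixedPoint_of_norm_le {Ψ : ℂ → ℂ} (hd : DifferentiableOn ℂ Ψ (Metric.ball 0 1))
    (hb : ∀ s ∈ Metric.ball (0 : ℂ) 1, ‖Ψ s‖ ≤ 1 / 8) : ∃ s : ℂ, ‖s‖ ≤ 1 / 2 ∧ Ψ s = s := by
  have hsub : ∀ s ∈ Metric.closedBall (0 : ℂ) (1 / 2),
      Metric.closedBall s (1 / 4) ⊆ Metric.ball 0 1 := fun s hs t ht => by
    rw [Metric.mem_ball, Metric.mem_closedBall] at *
    linarith [dist_triangle t s 0]
  have hderiv : ∀ s ∈ Metric.closedBall (0 : ℂ) (1 / 2), ‖deriv Ψ s‖₊ ≤ 1 / 2 := fun s hs => by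
    have h := Complex.norm_deriv_le_of_forall_mem_sphere_norm_le (f := Ψ) (c := s) (R := 1 / 4)
      (C := 1 / 8) (by norm_num)
      ((hd.mono (hsub s hs)).diffContOnCl_ball le_rfl)
      (fun t ht => hb t (hsub s hs (Metric.sphere_subset_closedBall ht)))
    rw [← NNReal.coe_le_coe]
    push_cast
    linarith
  have hmaps : Set.MapsTo Ψ (Metric.closedBall 0 (1 / 2)) (Metric.closedBall 0 (1 / 2)) :=
    fun s hs => by
      have h := hb s (hsub s hs (Metric.mem_closedBall_self (by norm_num)))
      rw [Metric.mem_closedBall, dist_zero_right]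
      linarith
  have hlip : LipschitzOnWith (1 / 2) Ψ (Metric.closedBall 0 (1 / 2)) :=
    Convex.lipschitzOnWith_of_nnnorm_deriv_le
      (fun s hs => hd.differentiableAt (Metric.isOpen_ball.mem_nhds
        (hsub s hs (Metric.mem_closedBall_self (by norm_num))))) hderiv (convex_closedBall _ _)
  have hc : ContractingWith (1 / 2) (hmaps.restrict Ψ _ _) :=
    ⟨by rw [← NNReal.coe_lt_coe]; push_cast; norm_num, hlip.mapsToRestrict hmaps⟩
  obtain ⟨s, hs, hfix, -⟩ := hc.exists_fixedPoint' Metric.isClosed_closedBall.isComplete hmaps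
    (x := 0) (Metric.mem_closedBall_self (by norm_num)) (edist_ne_top _ _)
  exact ⟨s, by simpa using hs, hfix⟩

/-- The quasi-momentum inside the box, in the coordinate `s` of the unit disc. Its real part is
close to `τ`; the imaginary part `log (4 a² τ²) / a³` is chosen to leading order so that
`‖exp (-i a³ θ)‖` is the inverse modulus of the reflection coefficient at the edge. -/
noncomputable def quasiMomentum (a τ : ℝ) (s : ℂ) : ℂ :=
  τ + Complex.I * (Real.log (4 * (a * τ) ^ 2) + s) / (a ^ 3 : ℝ)

/-- The reflection coefficient at the edge of the box, in the coordinate `s` of the unit disc. -/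
noncomputable def reflectionCoeff (a τ : ℝ) (s : ℂ) : ℂ :=
  -Complex.I * Complex.exp (-s) / (4 * (a * τ) ^ 2 : ℝ)

theorem norm_sin_sub_self_le {z : ℂ} (hz : ‖z‖ ≤ 1) : ‖Complex.sin z - z‖ ≤ ‖z‖ ^ 2 := by
  have h := Complex.sin_bound hz
  have h0 := norm_nonneg z
  have h1 : ‖z ^ 3 / 6‖ = ‖z‖ ^ 3 / 6 := by simp
  have h2 : ‖Complex.sin z - z‖ ≤ ‖Complex.sin z - (z - z ^ 3 / 6)‖ + ‖z ^ 3 / 6‖ := by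
    have := norm_sub_le (Complex.sin z - (z - z ^ 3 / 6)) (z ^ 3 / 6)
    rwa [show Complex.sin z - (z - z ^ 3 / 6) - z ^ 3 / 6 = Complex.sin z - z by ring] at this
  have h3 : ‖z‖ ^ 3 ≤ ‖z‖ ^ 2 := pow_le_pow_of_le_one h0 hz (by norm_num)
  have h5 : ‖z‖ ^ 5 ≤ ‖z‖ ^ 2 := pow_le_pow_of_le_one h0 hz (by norm_num)
  nlinarith [sq_nonneg ‖z‖]

theorem norm_sin_le_two_mul {z : ℂ} (hz : ‖z‖ ≤ 1) : ‖Complex.sin z‖ ≤ 2 * ‖z‖ := by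
  have h := norm_sin_sub_self_le hz
  have h1 := norm_add_le (Complex.sin z - z) z
  rw [sub_add_cancel] at h1
  nlinarith [norm_nonneg z]

theorem norm_cos_le_two {z : ℂ} (hz : ‖z‖ ≤ 1) : ‖Complex.cos z‖ ≤ 2 := by
  have h := Complex.cos_bound hz
  have h0 := norm_nonneg z
  have h1 : ‖1 - z ^ 2 / 2‖ ≤ 1 + ‖z‖ ^ 2 / 2 := by
    refine (norm_sub_le _ _).trans (le_of_eq ?_)
    simp
  have h2 := norm_add_le (Complex.cos z - (1 - z ^ 2 / 2)) (1 - z ^ 2 / 2)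
  rw [sub_add_cancel] at h2
  have h3 : ‖z‖ ^ 2 ≤ 1 := pow_le_one₀ h0 hz
  have h4 : ‖z‖ ^ 4 ≤ 1 := pow_le_one₀ h0 hz
  linarith

section

variable {a τ : ℝ} {s : ℂ}

theorem tau_pos (ha : 0 < a) (h1 : 30 ≤ a * τ) : 0 < τ :=
  pos_of_mul_pos_right (by linarith : 0 < a * τ) ha.le

theorem norm_quasiMomentum_sub_le (ha : 0 < a) (h1 : 30 ≤ a * τ) (hs : ‖s‖ ≤ 1) :
    ‖quasiMomentum a τ s - τ‖ ≤ 4 * τ / a ^ 2 := by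
  have hlog0 : 0 ≤ Real.log (4 * (a * τ) ^ 2) := Real.log_nonneg (by nlinarith)
  have hlog : Real.log (4 * (a * τ) ^ 2) ≤ 4 * (a * τ) - 2 := by
    rw [show 4 * (a * τ) ^ 2 = (2 * (a * τ)) ^ 2 by ring, Real.log_pow]
    push_cast
    linarith [Real.log_le_sub_one_of_pos (show 0 < 2 * (a * τ) by linarith)]
  have hn : ‖(Real.log (4 * (a * τ) ^ 2) : ℂ) + s‖ ≤ 4 * (a * τ) := by
    refine (norm_add_le _ _).trans ?_
    rw [Complex.norm_real, Real.norm_of_nonneg hlog0]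
    linarith
  rw [quasiMomentum, add_sub_cancel_left, norm_div, norm_mul, Complex.norm_I, one_mul,
    Complex.norm_real, Real.norm_of_nonneg (by positivity), div_le_div_iff₀ (by positivity)
    (by positivity)]
  calc _ ≤ 4 * (a * τ) * a ^ 2 := by gcongr
    _ = _ := by ring

theorem le_of_le_mul_tau (ha : 0 < a) (h1 : 30 ≤ a * τ) (h2 : τ ≤ 1 / 200) : 6000 ≤ a := by
  nlinarith

theorem norm_quasiMomentum_sub_le' (ha : 0 < a) (h1 : 30 ≤ a * τ) (h2 : τ ≤ 1 / 200)
    (hs : ‖s‖ ≤ 1) : ‖quasiMomentum a τ s - τ‖ ≤ τ / 1000 := by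
  refine (norm_quasiMomentum_sub_le ha h1 hs).trans ?_
  have h6 := le_of_le_mul_tau ha h1 h2
  have hτ := tau_pos ha h1
  rw [div_le_div_iff₀ (by positivity) (by norm_num)]
  nlinarith [mul_le_mul_of_nonneg_left (show (4000 : ℝ) ≤ a ^ 2 by nlinarith) hτ.le]

theorem norm_quasiMomentum_le (ha : 0 < a) (h1 : 30 ≤ a * τ) (h2 : τ ≤ 1 / 200)
    (hs : ‖s‖ ≤ 1) : ‖quasiMomentum a τ s‖ ≤ 1001 / 1000 * τ := by
  have hτ := tau_pos ha h1
  have h := norm_add_le (quasiMomentum a τ s - τ) τ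
  rw [sub_add_cancel, Complex.norm_real, Real.norm_of_nonneg hτ.le] at h
  linarith [norm_quasiMomentum_sub_le' ha h1 h2 hs]

theorem norm_reflectionCoeff_le (h1 : 30 ≤ a * τ) (hs : ‖s‖ ≤ 1) :
    ‖reflectionCoeff a τ s‖ ≤ 1 / 900 := by
  have he : ‖Complex.exp (-s)‖ ≤ 4 := by
    refine (Complex.norm_exp_le_exp_norm _).trans ?_
    rw [norm_neg]
    exact (Real.exp_le_exp.2 hs).trans (by linarith [Real.exp_one_lt_d9])
  rw [reflectionCoeff, norm_div, norm_mul, norm_neg, Complex.norm_I, one_mul, Complex.norm_real,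
    Real.norm_of_nonneg (by positivity), div_le_div_iff₀ (by nlinarith) (by norm_num)]
  nlinarith

theorem norm_sin_quasiMomentum_sub_le (ha : 0 < a) (h1 : 30 ≤ a * τ) (h2 : τ ≤ 1 / 200)
    (hs : ‖s‖ ≤ 1) : ‖Complex.sin (quasiMomentum a τ s) - τ‖ ≤ τ / 100 := by
  have hτ := tau_pos ha h1
  have hθ := norm_quasiMomentum_le ha h1 h2 hs
  have hsin := norm_sin_sub_self_le (z := quasiMomentum a τ s) (by linarith)
  have h := norm_add_le (Complex.sin (quasiMomentum a τ s) - quasiMomentum a τ s)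
    (quasiMomentum a τ s - τ)
  rw [sub_add_sub_cancel] at h
  have hsq : ‖quasiMomentum a τ s‖ ^ 2 ≤ (1001 / 1000 * τ) ^ 2 :=
    pow_le_pow_left₀ (norm_nonneg _) hθ 2
  nlinarith [norm_quasiMomentum_sub_le' ha h1 h2 hs]

theorem norm_reflection_quadratic_le (ha : 0 < a) (h1 : 30 ≤ a * τ) (h2 : τ ≤ 1 / 200)
    (hs : ‖s‖ ≤ 1) : ‖-(2 * Complex.cos (quasiMomentum a τ s) * reflectionCoeff a τ s) +
      reflectionCoeff a τ s ^ 2‖ ≤ 1 / 100 := by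
  have hr := norm_reflectionCoeff_le h1 hs
  have hθ := norm_quasiMomentum_le ha h1 h2 hs
  have hcos := norm_cos_le_two (z := quasiMomentum a τ s) (by linarith)
  refine (norm_add_le _ _).trans ?_
  rw [norm_neg, norm_mul, norm_mul, norm_pow, Complex.norm_two]
  nlinarith [norm_nonneg (reflectionCoeff a τ s), norm_nonneg (Complex.cos (quasiMomentum a τ s)),
    mul_le_mul hcos hr (norm_nonneg _) zero_le_two]

theorem differentiable_quasiMomentum : Differentiable ℂ (quasiMomentum a τ) := by
  unfold quasiMomentum
  fun_prop

theorem differentiable_reflectionCoeff : Differentiable ℂ (reflectionCoeff a τ) := by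
  unfold reflectionCoeff
  fun_prop

/-- The relation between quasi-momentum and reflection coefficient at the edge of a box of height
`i / a²`. By construction `s ↦ (θ, r)` solves the equation `r exp (-i a³ θ) = ±1` exactly, so the
relation becomes a fixed-point equation for `s`. -/
theorem exists_quasiMomentum (ha : 0 < a) (h1 : 30 ≤ a * τ) (h2 : τ ≤ 1 / 200) :
    ∃ s : ℂ, ‖s‖ ≤ 1 / 2 ∧
      -4 * Complex.sin (quasiMomentum a τ s) ^ 2 * reflectionCoeff a τ s =
        Complex.I / a ^ 2 * (1 - 2 * Complex.cos (quasiMomentum a τ s) * reflectionCoeff a τ s +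
          reflectionCoeff a τ s ^ 2) := by
  have hτ := tau_pos ha h1
  have hτ' : (τ : ℂ) ≠ 0 := by exact_mod_cast hτ.ne'
  have ha' : (a : ℂ) ≠ 0 := by exact_mod_cast ha.ne'
  let A : ℂ → ℂ := fun s => Complex.sin (quasiMomentum a τ s) / τ - 1
  let B : ℂ → ℂ := fun s => -(2 * Complex.cos (quasiMomentum a τ s) * reflectionCoeff a τ s) +
      reflectionCoeff a τ s ^ 2
  have hA : ∀ s, ‖s‖ ≤ 1 → ‖A s‖ ≤ 1 / 100 := fun s hs => by
    have h := norm_sin_quasiMomentum_sub_le ha h1 h2 hs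
    have e : A s = (Complex.sin (quasiMomentum a τ s) - τ) / τ := by
      simp only [A]
      field_simp
    rw [e, norm_div, Complex.norm_real, Real.norm_of_nonneg hτ.le, div_le_iff₀ hτ]
    linarith
  have hB : ∀ s, ‖s‖ ≤ 1 → ‖B s‖ ≤ 1 / 100 := fun s hs =>
    norm_reflection_quadratic_le ha h1 h2 hs
  have hθd := differentiable_quasiMomentum (a := a) (τ := τ)
  have hrd := differentiable_reflectionCoeff (a := a) (τ := τ)
  have hslit : ∀ x : ℂ, ‖x‖ ≤ 1 / 100 → 1 + x ∈ Complex.slitPlane := fun x hx =>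
    Complex.mem_slitPlane_of_norm_lt_one (by linarith)
  obtain ⟨s, hs, hfix⟩ := exists_fixedPoint_of_norm_le
    (Ψ := fun s => 2 * Complex.log (1 + A s) - Complex.log (1 + B s)) (by
      intro s hs
      have hs' : ‖s‖ ≤ 1 := by simpa using (Metric.mem_ball.1 hs).le
      have hAd : DifferentiableAt ℂ A s := by fun_prop
      have hBd : DifferentiableAt ℂ B s := by fun_prop
      exact ((((hAd.const_add 1).clog (hslit _ (hA s hs'))).const_mul 2).sub
        ((hBd.const_add 1).clog (hslit _ (hB s hs')))).differentiableWithinAt) (by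
      intro s hs
      have hs' : ‖s‖ ≤ 1 := by simpa using (Metric.mem_ball.1 hs).le
      have hA' := hA s hs'
      have hB' := hB s hs'
      have hlA := Complex.norm_log_one_add_half_le_self (z := A s) (by linarith)
      have hlB := Complex.norm_log_one_add_half_le_self (z := B s) (by linarith)
      refine (norm_sub_le _ _).trans ?_
      rw [norm_mul, Complex.norm_two]
      linarith)
  refine ⟨s, hs, ?_⟩
  have hs1 : ‖s‖ ≤ 1 := by linarith
  have hA0 := Complex.slitPlane_ne_zero (hslit _ (hA s hs1))
  have hB0 := Complex.slitPlane_ne_zero (hslit _ (hB s hs1))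
  have hexp : Complex.exp s * (1 + B s) = (1 + A s) ^ 2 := by
    have : Complex.exp s = (1 + A s) ^ 2 / (1 + B s) := by
      conv_lhs => rw [← hfix]
      rw [Complex.exp_sub, Complex.exp_log hB0, two_mul, Complex.exp_add, Complex.exp_log hA0, sq]
    rw [this, div_mul_cancel₀ _ hB0]
  have hsin : Complex.sin (quasiMomentum a τ s) = τ * (1 + A s) := by
    simp only [A]
    field_simp
    ring
  have hBe : 1 - 2 * Complex.cos (quasiMomentum a τ s) * reflectionCoeff a τ s +
      reflectionCoeff a τ s ^ 2 = 1 + B s := by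
    simp only [B]
    ring
  rw [hBe, hsin, mul_pow, ← hexp, reflectionCoeff, Complex.exp_neg]
  have := Complex.exp_ne_zero s
  push_cast
  field_simp

end

/-! ### Location of the eigenvalues -/

/-- The spectral parameter `2 cos θ + i / a²`. -/
noncomputable def boxEnergy (a τ : ℝ) (s : ℂ) : ℂ :=
  2 * Complex.cos (quasiMomentum a τ s) + Complex.I / a ^ 2

section

variable {a τ : ℝ} {s : ℂ}

theorem norm_two_cos_sub_le (ha : 0 < a) (h1 : 30 ≤ a * τ) (h2 : τ ≤ 1 / 200) (hs : ‖s‖ ≤ 1) :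
    ‖2 * Complex.cos (quasiMomentum a τ s) - (2 * Real.cos τ : ℝ)‖ ≤ 1 / 100 / a ^ 2 := by
  have hτ := tau_pos ha h1
  have hθ := norm_quasiMomentum_le ha h1 h2 hs
  have hd := norm_quasiMomentum_sub_le ha h1 hs
  have hd' := norm_quasiMomentum_sub_le' ha h1 h2 hs
  have hp : ‖(quasiMomentum a τ s + τ) / 2‖ ≤ 2 * τ := by
    rw [norm_div, Complex.norm_two, div_le_iff₀ two_pos]
    refine (norm_add_le _ _).trans ?_
    rw [Complex.norm_real, Real.norm_of_nonneg hτ.le]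
    linarith
  have hm : ‖(quasiMomentum a τ s - τ) / 2‖ = ‖quasiMomentum a τ s - τ‖ / 2 := by
    rw [norm_div, Complex.norm_two]
  have hsp := norm_sin_le_two_mul (z := (quasiMomentum a τ s + τ) / 2) (by linarith)
  have hsm := norm_sin_le_two_mul (z := (quasiMomentum a τ s - τ) / 2) (by rw [hm]; linarith)
  rw [hm] at hsm
  push_cast
  rw [← mul_sub, Complex.cos_sub_cos, norm_mul, norm_mul, norm_mul, norm_neg, Complex.norm_two]
  calc 2 * (2 * ‖Complex.sin ((quasiMomentum a τ s + τ) / 2)‖ *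
        ‖Complex.sin ((quasiMomentum a τ s - τ) / 2)‖)
      ≤ 2 * (2 * (4 * τ) * (4 * τ / a ^ 2)) := by
        gcongr
        · linarith
        · linarith
    _ = 64 * τ ^ 2 / a ^ 2 := by ring
    _ ≤ 1 / 100 / a ^ 2 := by
        gcongr
        nlinarith

theorem norm_boxEnergy_sub_cos_le (ha : 0 < a) (h1 : 30 ≤ a * τ) (h2 : τ ≤ 1 / 200)
    (hs : ‖s‖ ≤ 1) : ‖boxEnergy a τ s - (2 * Real.cos τ : ℝ)‖ ≤ 2 / a ^ 2 := by
  have h := norm_two_cos_sub_le ha h1 h2 hs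
  have hI : ‖Complex.I / (a : ℂ) ^ 2‖ = 1 / a ^ 2 := by
    rw [norm_div, Complex.norm_I, norm_pow, Complex.norm_real, Real.norm_of_nonneg ha.le]
  rw [boxEnergy, add_sub_right_comm]
  refine (norm_add_le _ _).trans ?_
  rw [hI]
  have : 0 < 1 / a ^ 2 := by positivity
  have e1 : 1 / 100 / a ^ 2 = 1 / 100 * (1 / a ^ 2) := by ring
  have e2 : 2 / a ^ 2 = 2 * (1 / a ^ 2) := by ring
  rw [e1] at h
  rw [e2]
  linarith

theorem le_im_boxEnergy (ha : 0 < a) (h1 : 30 ≤ a * τ) (h2 : τ ≤ 1 / 200) (hs : ‖s‖ ≤ 1) :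
    1 / (2 * a ^ 2) ≤ (boxEnergy a τ s).im := by
  have h := (Complex.abs_im_le_norm _).trans (norm_two_cos_sub_le ha h1 h2 hs)
  rw [Complex.sub_im, Complex.ofReal_im, sub_zero] at h
  have hI : (Complex.I / (a : ℂ) ^ 2).im = 1 / a ^ 2 := by
    rw [← Complex.ofReal_pow, Complex.div_ofReal_im, Complex.I_im]
  have : 0 < 1 / a ^ 2 := by positivity
  have e1 : 1 / 100 / a ^ 2 = 1 / 100 * (1 / a ^ 2) := by ring
  have e2 : 1 / (2 * a ^ 2) = 1 / 2 * (1 / a ^ 2) := by ring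
  rw [e1] at h
  rw [boxEnergy, Complex.add_im, hI, e2]
  linarith [neg_le_of_abs_le h]

theorem im_boxEnergy_pos (ha : 0 < a) (h1 : 30 ≤ a * τ) (h2 : τ ≤ 1 / 200) (hs : ‖s‖ ≤ 1) :
    0 < (boxEnergy a τ s).im :=
  lt_of_lt_of_le (by positivity) (le_im_boxEnergy ha h1 h2 hs)

theorem le_distInterval_boxEnergy (ha : 0 < a) (h1 : 30 ≤ a * τ) (h2 : τ ≤ 1 / 200)
    (hs : ‖s‖ ≤ 1) : 1 / (2 * a ^ 2) ≤ distInterval (boxEnergy a τ s) := by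
  refine (Metric.le_infDist (Set.Nonempty.image _ (Set.nonempty_Icc.2 (by norm_num)))).2 ?_
  rintro _ ⟨x, -, rfl⟩
  have h := (le_abs_self _).trans (Complex.abs_im_le_norm (boxEnergy a τ s - x))
  rw [Complex.sub_im, Complex.ofReal_im, sub_zero] at h
  rw [dist_eq_norm]
  exact (le_im_boxEnergy ha h1 h2 hs).trans h

theorem distInterval_boxEnergy_le (ha : 0 < a) (h1 : 30 ≤ a * τ) (h2 : τ ≤ 1 / 200)
    (hs : ‖s‖ ≤ 1) : distInterval (boxEnergy a τ s) ≤ 2 / a ^ 2 := by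
  have hmem : ((2 * Real.cos τ : ℝ) : ℂ) ∈ Complex.ofReal '' Set.Icc (-2) 2 :=
    ⟨2 * Real.cos τ, ⟨by linarith [Real.neg_one_le_cos τ], by linarith [Real.cos_le_one τ]⟩, rfl⟩
  refine (Metric.infDist_le_dist_of_mem hmem).trans ?_
  rw [dist_eq_norm]
  exact norm_boxEnergy_sub_cos_le ha h1 h2 hs

theorem inv_sq_le (ha : 0 < a) (h1 : 30 ≤ a * τ) : 2 / a ^ 2 ≤ τ ^ 2 / 450 := by
  rw [div_le_div_iff₀ (by positivity) (by norm_num)]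
  nlinarith

theorem two_sub_two_cos_bounds (hτ : 0 < τ) (h2 : τ ≤ 1 / 200) :
    9 / 10 * τ ^ 2 ≤ 2 - 2 * Real.cos τ ∧ 2 - 2 * Real.cos τ ≤ τ ^ 2 := by
  have h := Real.cos_bound (x := τ) (by rw [abs_of_pos hτ]; linarith)
  rw [abs_of_pos hτ] at h
  have h4 : τ ^ 4 ≤ τ ^ 2 * (1 / 10) := by
    rw [show τ ^ 4 = τ ^ 2 * τ ^ 2 by ring]
    gcongr
    nlinarith
  refine ⟨?_, ?_⟩
  · linarith [le_of_abs_le h, sq_nonneg τ]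
  · linarith [Real.one_sub_sq_div_two_le_cos (x := τ)]

theorem norm_boxEnergy_sub_two (ha : 0 < a) (h1 : 30 ≤ a * τ) (h2 : τ ≤ 1 / 200)
    (hs : ‖s‖ ≤ 1) : τ ^ 2 / 2 ≤ ‖boxEnergy a τ s - 2‖ ∧ ‖boxEnergy a τ s - 2‖ ≤ 2 * τ ^ 2 := by
  have hτ := tau_pos ha h1
  obtain ⟨hl, hu⟩ := two_sub_two_cos_bounds hτ h2
  have h := norm_boxEnergy_sub_cos_le ha h1 h2 hs
  have hinv := inv_sq_le ha h1
  have hn : ‖((2 * Real.cos τ : ℝ) : ℂ) - 2‖ = 2 - 2 * Real.cos τ := by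
    rw [show ((2 * Real.cos τ : ℝ) : ℂ) - 2 = ((2 * Real.cos τ - 2 : ℝ) : ℂ) by push_cast; ring,
      Complex.norm_real, Real.norm_eq_abs, abs_sub_comm, abs_of_nonneg (by nlinarith)]
  have e : boxEnergy a τ s - 2 = (boxEnergy a τ s - (2 * Real.cos τ : ℝ)) +
      (((2 * Real.cos τ : ℝ) : ℂ) - 2) := by ring
  have hτ2 := sq_nonneg τ
  constructor
  · have h3 := norm_sub_le (boxEnergy a τ s - 2) (boxEnergy a τ s - (2 * Real.cos τ : ℝ))
    rw [sub_sub_sub_cancel_left, hn] at h3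
    linarith
  · rw [e]
    refine (norm_add_le _ _).trans ?_
    rw [hn]
    linarith

theorem norm_boxEnergy_add_two (ha : 0 < a) (h1 : 30 ≤ a * τ) (h2 : τ ≤ 1 / 200)
    (hs : ‖s‖ ≤ 1) : 3 ≤ ‖boxEnergy a τ s + 2‖ ∧ ‖boxEnergy a τ s + 2‖ ≤ 5 := by
  have hτ := tau_pos ha h1
  have h := (norm_boxEnergy_sub_two ha h1 h2 hs).2
  have hτ2 : τ ^ 2 ≤ 1 / 100 := by nlinarith
  constructor
  · have h3 := norm_sub_le (boxEnergy a τ s + 2) (boxEnergy a τ s - 2)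
    rw [show boxEnergy a τ s + 2 - (boxEnergy a τ s - 2) = 4 by ring] at h3
    norm_num at h3
    linarith
  · have h3 := norm_add_le (boxEnergy a τ s - 2) 4
    rw [show boxEnergy a τ s - 2 + 4 = boxEnergy a τ s + 2 by ring] at h3
    norm_num at h3
    linarith

theorem le_distEndpoints_boxEnergy (ha : 0 < a) (h1 : 30 ≤ a * τ) (h2 : τ ≤ 1 / 200)
    (hs : ‖s‖ ≤ 1) : τ ^ 2 / 2 ≤ distEndpoints (boxEnergy a τ s) := by
  have hτ := tau_pos ha h1
  refine (Metric.le_infDist (Set.insert_nonempty _ _)).2 ?_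
  rintro y (rfl | rfl)
  · rw [dist_eq_norm, sub_neg_eq_add]
    have := (norm_boxEnergy_add_two ha h1 h2 hs).1
    nlinarith
  · rw [dist_eq_norm]
    exact (norm_boxEnergy_sub_two ha h1 h2 hs).1

theorem norm_sq_sub_four_rpow_le (ha : 0 < a) (h1 : 30 ≤ a * τ) (h2 : τ ≤ 1 / 200)
    (hs : ‖s‖ ≤ 1) : ‖boxEnergy a τ s ^ 2 - 4‖ ^ (1 / 2 : ℝ) ≤ 4 * τ := by
  have hτ := tau_pos ha h1
  rw [← Real.sqrt_eq_rpow]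
  refine Real.sqrt_le_iff.2 ⟨by positivity, ?_⟩
  rw [show boxEnergy a τ s ^ 2 - 4 = (boxEnergy a τ s - 2) * (boxEnergy a τ s + 2) by ring,
    norm_mul]
  have := mul_le_mul (norm_boxEnergy_sub_two ha h1 h2 hs).2 (norm_boxEnergy_add_two ha h1 h2 hs).2
    (norm_nonneg _) (by positivity)
  nlinarith

theorem norm_sq_sub_four_rpow_pos (ha : 0 < a) (h1 : 30 ≤ a * τ) (h2 : τ ≤ 1 / 200)
    (hs : ‖s‖ ≤ 1) : 0 < ‖boxEnergy a τ s ^ 2 - 4‖ ^ (1 / 2 : ℝ) := by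
  have hτ := tau_pos ha h1
  refine Real.rpow_pos_of_pos ?_ _
  rw [show boxEnergy a τ s ^ 2 - 4 = (boxEnergy a τ s - 2) * (boxEnergy a τ s + 2) by ring,
    norm_mul]
  have h3 := (norm_boxEnergy_sub_two ha h1 h2 hs).1
  have h4 := (norm_boxEnergy_add_two ha h1 h2 hs).1
  have : 0 < τ ^ 2 / 2 := by positivity
  exact mul_pos (by linarith) (by linarith)

/-- The eigenvalue contributes at least a constant times `a^{-2p} f(log (a τ / 2)²) / τ`; since
`f` is monotone, a lower bound for its argument is enough. -/
theorem le_weight_boxEnergy {p : ℝ} (hp : 1 ≤ p) {f : ℝ → ℝ} (hf : MonotoneOn f (Set.Ici 0))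
    (hf0 : ∀ t, 0 ≤ t → 0 < f t) (ha : 0 < a) (h1 : 30 ≤ a * τ) (h2 : τ ≤ 1 / 200)
    (hs : ‖s‖ ≤ 1) :
    (1 / (2 * a ^ 2)) ^ p / (4 * τ) * f (2 * Real.log (a * τ / 2)) ≤
      weight p f (boxEnergy a τ s) := by
  have hτ := tau_pos ha h1
  have hdl := le_distInterval_boxEnergy ha h1 h2 hs
  have hdu := distInterval_boxEnergy_le ha h1 h2 hs
  have he := le_distEndpoints_boxEnergy ha h1 h2 hs
  have hd0 : 0 < distInterval (boxEnergy a τ s) := lt_of_lt_of_le (by positivity) hdl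
  have he0 : 0 < distEndpoints (boxEnergy a τ s) := lt_of_lt_of_le (by positivity) he
  have hlog0 : 0 ≤ 2 * Real.log (a * τ / 2) :=
    mul_nonneg two_pos.le (Real.log_nonneg (by linarith))
  have hlog : 2 * Real.log (a * τ / 2) ≤
      -Real.log (distInterval (boxEnergy a τ s) / distEndpoints (boxEnergy a τ s)) := by
    rw [← Real.log_inv, inv_div]
    have e : 2 * Real.log (a * τ / 2) = Real.log ((τ ^ 2 / 2) / (2 / a ^ 2)) := by
      rw [show (τ ^ 2 / 2) / (2 / a ^ 2) = (a * τ / 2) ^ 2 by field_simp, Real.log_pow]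
      norm_num
    rw [e]
    apply Real.log_le_log (by positivity)
    gcongr
  unfold weight
  have hfm := hf hlog0 (hlog0.trans hlog) hlog
  have hfp := hf0 _ hlog0
  have hq := norm_sq_sub_four_rpow_pos ha h1 h2 hs
  have hq' := norm_sq_sub_four_rpow_le ha h1 h2 hs
  gcongr

/-- Distinct centres `τ` give distinct eigenvalues: `Re θ` differs from `τ` by less than half the
spacing, and the cosine is injective on the strip `0 < Re θ < 1`. -/
theorem eq_of_boxEnergy_eq {τ' : ℝ} {s' : ℂ} (ha : 0 < a) (h1 : 30 ≤ a * τ) (h2 : τ ≤ 1 / 200)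
    (hs : ‖s‖ ≤ 1 / 2) (h1' : 30 ≤ a * τ') (h2' : τ' ≤ 1 / 200) (hs' : ‖s'‖ ≤ 1 / 2)
    (h : boxEnergy a τ s = boxEnergy a τ' s') : |τ - τ'| ≤ 1 / a ^ 3 := by
  have hcos : Complex.cos (quasiMomentum a τ s) = Complex.cos (quasiMomentum a τ' s') := by
    have := add_right_cancel h
    exact mul_left_cancel₀ two_ne_zero this
  have hstrip : ∀ {τ : ℝ} {s : ℂ}, 30 ≤ a * τ → τ ≤ 1 / 200 → ‖s‖ ≤ 1 / 2 →
      0 < (quasiMomentum a τ s).re ∧ (quasiMomentum a τ s).re < 1 := fun {τ s} h1 h2 hs => by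
    have hτ := tau_pos ha h1
    have h3 := (Complex.abs_re_le_norm _).trans
      (norm_quasiMomentum_sub_le' ha h1 h2 (hs.trans (by norm_num)))
    rw [Complex.sub_re, Complex.ofReal_re] at h3
    obtain ⟨h4, h5⟩ := abs_le.1 h3
    constructor <;> linarith
  have hre : ∀ {τ : ℝ} {s : ℂ}, (quasiMomentum a τ s).re = τ - s.im / a ^ 3 := fun {τ s} => by
    rw [quasiMomentum, Complex.add_re, Complex.div_ofReal_re]
    simp [neg_div, sub_eq_add_neg]
  obtain ⟨hl, hu⟩ := hstrip h1 h2 hs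
  obtain ⟨hl', hu'⟩ := hstrip h1' h2' hs'
  obtain ⟨k, hk⟩ := Complex.cos_eq_cos_iff.1 hcos
  have hpi := Real.pi_gt_three
  have hkre : ∀ x : ℂ, (2 * (k : ℂ) * (Real.pi : ℂ) + x).re = 2 * k * Real.pi + x.re := fun x => by
    have : (2 * (k : ℂ) * (Real.pi : ℂ)) = ((2 * k * Real.pi : ℝ) : ℂ) := by push_cast; ring
    rw [this, Complex.add_re, Complex.ofReal_re]
  have hrange : ∀ y : ℝ, -1 < y → y < 2 → y = 2 * k * Real.pi → (k : ℝ) = 0 := by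
    intro y hy1 hy2 hy
    have hk1 : (-1 : ℝ) < k := by nlinarith
    have hk2 : (k : ℝ) < 1 := by nlinarith
    have : k = 0 := by
      have h3 : (-1 : ℤ) < k := by exact_mod_cast hk1
      have h4 : k < (1 : ℤ) := by exact_mod_cast hk2
      omega
    simp [this]
  have heq : (quasiMomentum a τ' s').re = (quasiMomentum a τ s).re := by
    rcases hk with hk | hk
    · have hk' := congrArg Complex.re hk
      rw [hkre] at hk'
      have h0 := hrange ((quasiMomentum a τ' s').re - (quasiMomentum a τ s).re)
        (by linarith) (by linarith) (by linarith)
      rw [h0] at hk'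
      linarith
    · have hk' := congrArg Complex.re hk
      rw [sub_eq_add_neg, hkre, Complex.neg_re] at hk'
      have h0 := hrange ((quasiMomentum a τ' s').re + (quasiMomentum a τ s).re)
        (by linarith) (by linarith) (by linarith)
      rw [h0] at hk'
      linarith
  rw [hre, hre] at heq
  have e : τ - τ' = (s.im - s'.im) / a ^ 3 := by
    rw [sub_div]
    linarith
  rw [e, abs_div, abs_of_pos (show 0 < a ^ 3 by positivity)]
  gcongr
  have h3 := (Complex.abs_im_le_norm s).trans hs
  have h4 := (Complex.abs_im_le_norm s').trans hs'
  rw [abs_le] at *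
  constructor <;> linarith

theorem norm_lt_one_of_im_add_inv_pos {κ : ℂ} (hκ : κ.im < 0) (h : 0 < (κ + κ⁻¹).im) :
    ‖κ‖ < 1 := by
  have hκ0 : κ ≠ 0 := fun h0 => by simp [h0] at hκ
  have hn : 0 < Complex.normSq κ := Complex.normSq_pos.2 hκ0
  rw [Complex.add_im, Complex.inv_im] at h
  by_contra hge
  have h1 : 1 ≤ Complex.normSq κ := by
    rw [Complex.normSq_eq_norm_sq]
    nlinarith [not_lt.1 hge]
  have h2 : -κ.im / Complex.normSq κ ≤ -κ.im := div_le_self (by linarith) h1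
  linarith

theorem rpow_neg_two_thirds {n : ℕ} (ha : 0 < a) (han : a ^ 3 = n) :
    (n : ℝ) ^ (-2 / 3 : ℝ) = 1 / a ^ 2 := by
  rw [← han, ← Real.rpow_natCast, ← Real.rpow_mul ha.le, one_div, ← Real.rpow_natCast,
    ← Real.rpow_neg ha.le]
  norm_num

/-- The outer decay rate is `κ = (w - r) / (1 - r w)` with `w = exp (-i θ)`. It is close to `w`,
hence in the lower half-plane; as `Im (κ + κ⁻¹) > 0`, it lies in the unit disc. -/
theorem exists_eigenvalue {n m : ℕ} (ha : 0 < a) (han : a ^ 3 = n)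
    (hτ : τ = Real.pi * (m + 1 / 2) / n) (h1 : 30 ≤ a * τ) (h2 : τ ≤ 1 / 200) :
    ∃ s : ℂ, ‖s‖ ≤ 1 / 2 ∧
      Module.End.HasEigenvalue (jacobi 1 (box n) 1 : ℓ^2(ℤ, ℂ) →ₗ[ℂ] ℓ^2(ℤ, ℂ))
        (boxEnergy a τ s) := by
  obtain ⟨s, hs, hquad⟩ := exists_quasiMomentum ha h1 h2
  refine ⟨s, hs, ?_⟩
  have hs1 : ‖s‖ ≤ 1 := hs.trans (by norm_num)
  have hτ0 := tau_pos ha h1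
  have ha' : (a : ℂ) ≠ 0 := by exact_mod_cast ha.ne'
  have hτ' : (τ : ℂ) ≠ 0 := by exact_mod_cast hτ0.ne'
  have hn0 : (n : ℝ) ≠ 0 := by
    rw [← han]
    positivity
  have hθ := norm_quasiMomentum_le ha h1 h2 hs1
  have hθd := norm_quasiMomentum_sub_le' ha h1 h2 hs1
  have hsin := norm_sin_quasiMomentum_sub_le ha h1 h2 hs1
  have hr := norm_reflectionCoeff_le h1 hs1
  have him := im_boxEnergy_pos ha h1 h2 hs1
  -- The matching condition `r wⁿ = -ρ` with parity `ρ = (-1)ᵐ`, as `exp (i n τ) = (-1)ᵐ i`.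
  have hrw : reflectionCoeff a τ s * Complex.exp (-Complex.I * quasiMomentum a τ s) ^ n =
      -(-1) ^ m := by
    have e1 : (n : ℂ) * (-Complex.I * quasiMomentum a τ s) =
        -(m * (Real.pi * Complex.I)) + -(Real.pi / 2 * Complex.I) +
          (Real.log (4 * (a * τ) ^ 2) : ℂ) + s := by
      have ht : (n : ℂ) * τ = Real.pi * (m + 1 / 2) := by
        have : (n : ℝ) * τ = Real.pi * (m + 1 / 2) := by
          rw [hτ]
          field_simp
        have h := congrArg Complex.ofReal this
        push_cast at h
        exact h
      have hnc : ((a ^ 3 : ℝ) : ℂ) = n := by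
        rw [han]
        simp
      have hnc0 : (n : ℂ) ≠ 0 := by exact_mod_cast hn0
      rw [quasiMomentum, hnc]
      generalize (Real.log (4 * (a * τ) ^ 2) : ℂ) = ℓ
      have e : (n : ℂ) * (-Complex.I * (τ + Complex.I * (ℓ + s) / n)) =
          -Complex.I * (n * τ) - Complex.I ^ 2 * (ℓ + s) := by
        field_simp
        ring
      rw [e, ht]
      linear_combination -(ℓ + s) * Complex.I_sq
    have hpos : 0 < 4 * (a * τ) ^ 2 := by positivity
    have e2 : Complex.exp (-(m * (Real.pi * Complex.I))) = (-1) ^ m := by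
      rw [← mul_neg, Complex.exp_nat_mul, Complex.exp_neg, Complex.exp_pi_mul_I]
      norm_num
    have e3 : Complex.exp (-(Real.pi / 2 * Complex.I)) = -Complex.I := by
      rw [Complex.exp_neg, Complex.exp_pi_div_two_mul_I, Complex.inv_I]
    rw [← Complex.exp_nat_mul, e1, Complex.exp_add, Complex.exp_add, Complex.exp_add, e2, e3,
      ← Complex.ofReal_exp, Real.exp_log hpos, reflectionCoeff, Complex.exp_neg]
    have := Complex.exp_ne_zero s
    push_cast
    field_simp
    linear_combination Complex.I_sq
  set θ := quasiMomentum a τ s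
  set r := reflectionCoeff a τ s
  set w := Complex.exp (-Complex.I * θ) with hw
  have hw0 : w ≠ 0 := Complex.exp_ne_zero _
  have hwinv : w⁻¹ = Complex.exp (Complex.I * θ) := by
    rw [hw, ← Complex.exp_neg]
    ring_nf
  have hcosw : 2 * Complex.cos θ = w + w⁻¹ := by
    rw [hwinv, hw, Complex.two_cos, add_comm]
    ring_nf
  have hsinw : 2 * Complex.sin θ = (w - w⁻¹) * Complex.I := by
    rw [hwinv, hw, Complex.two_sin]
    ring_nf
  have hwlin : ‖w - 1 - -Complex.I * θ‖ ≤ ‖θ‖ ^ 2 := by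
    have h := Complex.norm_exp_sub_one_sub_id_le (x := -Complex.I * θ)
      (by rw [norm_mul, norm_neg, Complex.norm_I, one_mul]; linarith)
    rwa [norm_mul, norm_neg, Complex.norm_I, one_mul] at h
  have hθsq : ‖θ‖ ^ 2 ≤ τ / 100 := by nlinarith [norm_nonneg θ]
  have hwn : ‖w‖ ≤ 2 := by
    have h := norm_add_le (w - 1 - -Complex.I * θ) (1 + -Complex.I * θ)
    have h' := norm_add_le (1 : ℂ) (-Complex.I * θ)
    rw [norm_mul, norm_neg, Complex.norm_I, one_mul, norm_one] at h'
    rw [show w - 1 - -Complex.I * θ + (1 + -Complex.I * θ) = w by ring] at h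
    linarith
  have hwim : w.im ≤ -(9 / 10) * τ := by
    have h := le_of_abs_le ((Complex.abs_im_le_norm _).trans hwlin)
    have h3 := neg_le_of_abs_le ((Complex.abs_re_le_norm _).trans hθd)
    rw [Complex.sub_re, Complex.ofReal_re] at h3
    have e : (w - 1 - -Complex.I * θ).im = w.im + θ.re := by simp
    rw [e] at h
    linarith
  have hsn : ‖Complex.sin θ‖ ≤ 2 * τ := by
    have h := norm_add_le (Complex.sin θ - τ) τ
    rw [sub_add_cancel, Complex.norm_real, Real.norm_of_nonneg hτ0.le] at h
    linarith
  have hs0 : Complex.sin θ ≠ 0 := fun h0 => by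
    rw [h0, zero_sub, norm_neg, Complex.norm_real, Real.norm_of_nonneg hτ0.le] at hsin
    linarith
  have hw2 : w ^ 2 ≠ 1 := fun h => by
    have : w = w⁻¹ := eq_inv_of_mul_eq_one_left (by rw [← sq, h])
    rw [← this, sub_self, zero_mul] at hsinw
    exact hs0 (by simpa using hsinw)
  have hrwn : ‖r * w‖ ≤ 1 / 450 := by
    rw [norm_mul]
    nlinarith [norm_nonneg r, norm_nonneg w]
  have hden : 1 / 2 ≤ ‖1 - r * w‖ := by
    have h := norm_sub_norm_le (1 : ℂ) (r * w)
    rw [norm_one] at h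
    linarith
  have hden0 : 1 - r * w ≠ 0 := norm_pos_iff.1 (by linarith)
  have hden0' : 1 - w * r ≠ 0 := by rwa [mul_comm]
  set κ := (w - r) / (1 - r * w) with hκ
  have hκw : κ - w = -r * (w * (w⁻¹ - w)) / (1 - r * w) := by
    rw [hκ]
    field_simp
    ring
  have hκwn : ‖κ - w‖ ≤ τ / 10 := by
    have hd : ‖w⁻¹ - w‖ ≤ 4 * τ := by
      have h := congrArg norm hsinw
      rw [norm_mul, norm_mul, Complex.norm_two, Complex.norm_I, mul_one] at h
      rw [norm_sub_rev]
      linarith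
    rw [hκw, norm_div, div_le_iff₀ (by linarith), norm_mul, norm_mul, norm_neg]
    calc ‖r‖ * (‖w‖ * ‖w⁻¹ - w‖) ≤ 1 / 900 * (2 * (4 * τ)) := by gcongr
      _ ≤ τ / 10 * (1 / 2) := by linarith
      _ ≤ _ := by gcongr
  have hκim : κ.im < 0 := by
    have h := le_of_abs_le ((Complex.abs_im_le_norm _).trans hκwn)
    rw [Complex.sub_im] at h
    linarith
  have hκ0 : κ ≠ 0 := fun h0 => by
    rw [h0] at hκim
    simp at hκim
  have hnum0 : w - r ≠ 0 := fun h0 => hκ0 (by rw [hκ, h0, zero_div])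
  have hpow := rpow_neg_two_thirds ha han
  have hz : κ + κ⁻¹ = w + w⁻¹ + Complex.I / a ^ 2 := by
    have hs2 : 4 * Complex.sin θ ^ 2 = -(w - w⁻¹) ^ 2 := by
      linear_combination (2 * Complex.sin θ + (w - w⁻¹) * Complex.I) * hsinw +
        (w - w⁻¹) ^ 2 * Complex.I_sq
    have hq : (w - w⁻¹) ^ 2 * r = Complex.I / a ^ 2 * (1 - (w + w⁻¹) * r + r ^ 2) := by
      rw [← hcosw, ← hquad]
      linear_combination r * hs2
    have hprod : (w - r) * (1 - r * w) = w * (1 - (w + w⁻¹) * r + r ^ 2) := by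
      field_simp
      ring
    have hd : Complex.I / a ^ 2 = (w - w⁻¹) ^ 2 * r * w / ((w - r) * (1 - r * w)) := by
      rw [eq_div_iff (mul_ne_zero hnum0 hden0), hprod]
      linear_combination -w * hq
    rw [hd, hκ]
    field_simp
    ring
  have henergy : boxEnergy a τ s = κ + κ⁻¹ := by
    rw [hz, boxEnergy, hcosw]
  rw [henergy] at him ⊢
  have hρ : ((-1 : ℂ) ^ m) ^ 2 = 1 := by
    rw [← pow_mul, mul_comm, pow_mul]
    norm_num
  refine hasEigenvalue_jacobi_box (ρ := (-1) ^ m) hw0 hw2 hκ0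
    (norm_lt_one_of_im_add_inv_pos hκim him) hρ ?_ ?_
  · rw [hz, hpow]
    push_cast
    ring
  · rw [hκ, div_mul_eq_mul_div, eq_div_iff hden0, pow_succ]
    linear_combination (1 - w ^ 2) * (-1) ^ m * hrw + (w ^ 2 - 1) * hρ

end

/-! ### Summation over the eigenvalues -/

theorem deviation_box (n : ℕ) (k : ℤ) : deviation 1 (box n) 1 k = ‖boxValue n k‖ := by
  simp [deviation, box_apply]

theorem norm_boxValue_of_mem {n : ℕ} {k : ℤ} (hk : k ∈ Finset.Icc (1 : ℤ) n) :
    ‖boxValue n k‖ = (n : ℝ) ^ (-2 / 3 : ℝ) := by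
  rw [boxValue_of_mem hk, norm_mul, Complex.norm_I, one_mul, Complex.norm_real,
    Real.norm_of_nonneg (by positivity)]

theorem tsum_deviation_box {p : ℝ} (hp : 1 ≤ p) (n : ℕ) :
    ∑' k : ℤ, ENNReal.ofReal (deviation 1 (box n) 1 k ^ p) =
      ENNReal.ofReal (n * ((n : ℝ) ^ (-2 / 3 : ℝ)) ^ p) := by
  rw [tsum_eq_sum (s := Finset.Icc (1 : ℤ) n)]
  · rw [Finset.sum_congr rfl (g := fun _ => ENNReal.ofReal (((n : ℝ) ^ (-2 / 3 : ℝ)) ^ p))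
      fun k hk => by rw [deviation_box, norm_boxValue_of_mem hk], Finset.sum_const,
      ENNReal.ofReal_mul (by positivity)]
    simp
  · intro k hk
    rw [deviation_box, boxValue_of_notMem hk, norm_zero, Real.zero_rpow (by linarith),
      ENNReal.ofReal_zero]

theorem ratio_box_le_supRatio {p : ℝ} (f : ℝ → ℝ) {n : ℕ} (hn : 1 ≤ n) :
    ratio p f 1 (box n) 1 ≤ supRatio p f := by
  have h0 : deviation 1 (box n) 1 ≠ 0 := fun h => by
    have h1 := congrFun h 1
    rw [deviation_box, norm_boxValue_of_mem (by simp; omega)] at h1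
    have : 0 < (n : ℝ) ^ (-2 / 3 : ℝ) := Real.rpow_pos_of_pos (by exact_mod_cast hn) _
    exact this.ne' h1
  have hmem : Memℓp (deviation 1 (box n) 1) (ENNReal.ofReal p) := by
    refine (memℓp_zero ((Finset.Icc (1 : ℤ) n).finite_toSet.subset fun k hk => ?_)).of_exponent_ge
      zero_le
    by_contra hk'
    refine hk ?_
    rw [deviation_box, boxValue_of_notMem (by simpa using hk'), norm_zero]
  exact le_iSup_of_le 1 (le_iSup_of_le (box n) (le_iSup_of_le 1 (le_iSup_of_le h0
    (le_iSup_of_le hmem le_rfl))))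

theorem sum_weight_le_eigenvalueSum {p : ℝ} {f : ℝ → ℝ} {T : ℓ^2(ℤ, ℂ) →L[ℂ] ℓ^2(ℤ, ℂ)}
    {ι : Type*} (I : Finset ι) (e : ι → ℂ) (hinj : Set.InjOn e I)
    (hmem : ∀ m ∈ I, e m ∈ discreteSpectrum T) :
    ∑ m ∈ I, ENNReal.ofReal (weight p f (e m)) ≤ eigenvalueSum p f T := by
  let φ : I → discreteSpectrum T := fun m => ⟨e m, hmem m m.2⟩
  have hφ : Function.Injective φ := fun m m' h =>
    Subtype.ext (hinj m.2 m'.2 (congrArg Subtype.val h))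
  refine le_trans ?_ (ENNReal.tsum_comp_le_tsum_of_injective hφ
    fun z : discreteSpectrum T => (algMult T z : ℝ≥0∞) * ENNReal.ofReal (weight p f z))
  rw [tsum_fintype, ← Finset.sum_coe_sort]
  refine Finset.sum_le_sum fun m _ => ?_
  refine le_mul_of_one_le_left zero_le ?_
  exact_mod_cast one_le_algMult (φ m).2

section

variable {f : ℝ → ℝ}

theorem primitive_sub (hf : MonotoneOn f (Set.Ici 0)) {x y : ℝ} (hx : 0 ≤ x) (hxy : x ≤ y) :
    primitive f y - primitive f x = ∫ t in x..y, f t ∧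
      IntervalIntegrable f MeasureTheory.volume x y := by
  have hint : ∀ {u v : ℝ}, 0 ≤ u → u ≤ v → IntervalIntegrable f MeasureTheory.volume u v :=
    fun {u v} hu huv => MonotoneOn.intervalIntegrable (hf.mono fun t ht => by
      rw [Set.uIcc_of_le huv] at ht
      exact hu.trans ht.1)
  exact ⟨intervalIntegral.integral_interval_sub_left (hint le_rfl (hx.trans hxy))
    (hint le_rfl hx), hint hx hxy⟩

theorem primitive_sub_le (hf : MonotoneOn f (Set.Ici 0)) {x y : ℝ} (hx : 0 ≤ x) (hxy : x ≤ y) :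
    primitive f y - primitive f x ≤ (y - x) * f y := by
  obtain ⟨h, hint⟩ := primitive_sub hf hx hxy
  rw [h, ← smul_eq_mul, ← intervalIntegral.integral_const]
  exact intervalIntegral.integral_mono_on hxy hint intervalIntegrable_const
    fun t ht => hf (hx.trans ht.1) (hx.trans hxy) ht.2

theorem le_primitive_sub (hf : MonotoneOn f (Set.Ici 0)) {x y : ℝ} (hx : 0 ≤ x) (hxy : x ≤ y) :
    (y - x) * f 0 ≤ primitive f y - primitive f x := by
  obtain ⟨h, hint⟩ := primitive_sub hf hx hxy
  rw [h, ← smul_eq_mul, ← intervalIntegral.integral_const]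
  exact intervalIntegral.integral_mono_on hxy intervalIntegrable_const hint
    fun t ht => hf Set.self_mem_Ici (hx.trans ht.1) (hx.trans ht.1)

theorem primitive_mono (hf : MonotoneOn f (Set.Ici 0)) (hf0 : ∀ t, 0 ≤ t → 0 < f t) {x y : ℝ}
    (hx : 0 ≤ x) (hxy : x ≤ y) : primitive f x ≤ primitive f y := by
  have := le_primitive_sub hf hx hxy
  nlinarith [hf0 0 le_rfl]

/-- The sum over the eigenvalues is a Riemann sum for `F = ∫ f` in the logarithmic variable
`2 log (c (m + 1/2))`. Right endpoints make it an upper sum, so that no regularity of `f` beyond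
monotonicity is used. -/
theorem primitive_sub_le_sum (hf : MonotoneOn f (Set.Ici 0)) (hf0 : ∀ t, 0 ≤ t → 0 < f t)
    {c : ℝ} (hc : 0 < c) {i₁ i₂ : ℕ} (hi₁ : 1 ≤ i₁) (hc1 : 1 ≤ c * (i₁ + 1 / 2))
    (hi : i₁ ≤ i₂) :
    primitive f (2 * Real.log (c * (i₂ + 1 / 2))) - primitive f (2 * Real.log (c * (i₁ + 1 / 2))) ≤
      ∑ m ∈ Finset.Ioc i₁ i₂, 4 / (m + 1 / 2 : ℝ) * f (2 * Real.log (c * (m + 1 / 2))) := by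
  induction i₂, hi using Nat.le_induction with
  | base => simp
  | succ i hi ih =>
    rw [← Finset.insert_Ioc_right_eq_Ioc_add_one hi, Finset.sum_insert (by simp)]
    have hi1 : (1 : ℝ) ≤ i := by exact_mod_cast hi₁.trans hi
    have hii : (i₁ : ℝ) ≤ i := by exact_mod_cast hi
    have hci : 1 ≤ c * (i + 1 / 2) := hc1.trans (by gcongr)
    have hx : 0 ≤ 2 * Real.log (c * (i + 1 / 2)) := mul_nonneg two_pos.le (Real.log_nonneg hci)
    have hxy : 2 * Real.log (c * (i + 1 / 2)) ≤ 2 * Real.log (c * ((i + 1 : ℕ) + 1 / 2)) := by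
      gcongr
      linarith
    have hstep := primitive_sub_le hf hx hxy
    have hlen : 2 * Real.log (c * ((i + 1 : ℕ) + 1 / 2)) - 2 * Real.log (c * (i + 1 / 2)) ≤
        4 / ((i + 1 : ℕ) + 1 / 2 : ℝ) := by
      rw [← mul_sub, ← Real.log_div (by positivity) (by positivity),
        mul_div_mul_left _ _ hc.ne']
      refine (mul_le_mul_of_nonneg_left (Real.log_le_sub_one_of_pos (by positivity))
        two_pos.le).trans ?_
      rw [div_sub_one (by positivity), ← mul_div_assoc, div_le_div_iff₀ (by positivity)
        (by positivity)]
      push_cast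
      nlinarith
    have := mul_le_mul_of_nonneg_right hlen (hf0 _ (hx.trans hxy)).le
    linarith

end

/-- The lower bound for the ratio in terms of a logarithmic Riemann sum. -/
theorem sum_le_ratio_box {p : ℝ} (hp : 1 ≤ p) {f : ℝ → ℝ} (hf : MonotoneOn f (Set.Ici 0))
    (hf0 : ∀ t, 0 ≤ t → 0 < f t) {n : ℕ} {a : ℝ} (ha : 0 < a) (han : a ^ 3 = n) {i₁ i₂ : ℕ}
    (h1 : 30 ≤ Real.pi / a ^ 2 * (i₁ + 1 / 2)) (h2 : Real.pi * (i₂ + 1 / 2) / n ≤ 1 / 200) :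
    ENNReal.ofReal ((1 / 2) ^ p / (16 * Real.pi) * ∑ m ∈ Finset.Ioc i₁ i₂,
      4 / (m + 1 / 2 : ℝ) * f (2 * Real.log (Real.pi / (2 * a ^ 2) * (m + 1 / 2)))) ≤
      ratio p f 1 (box n) 1 := by
  have hn : (0 : ℝ) < n := by
    rw [← han]
    positivity
  have hpi := Real.pi_pos
  let τ : ℕ → ℝ := fun m => Real.pi * (m + 1 / 2) / n
  have haτ : ∀ m, a * τ m = Real.pi / a ^ 2 * (m + 1 / 2) := fun m => by
    simp only [τ, ← han]
    field_simp
  have h1' : ∀ m ∈ Finset.Ioc i₁ i₂, 30 ≤ a * τ m := fun m hm => by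
    have : (i₁ : ℝ) ≤ m := by exact_mod_cast (Finset.mem_Ioc.1 hm).1.le
    rw [haτ]
    exact h1.trans (by gcongr)
  have h2' : ∀ m ∈ Finset.Ioc i₁ i₂, τ m ≤ 1 / 200 := fun m hm => by
    have : (m : ℝ) ≤ i₂ := by exact_mod_cast (Finset.mem_Ioc.1 hm).2
    refine le_trans ?_ h2
    simp only [τ]
    gcongr
  have hex : ∀ m : ℕ, ∃ s : ℂ, m ∈ Finset.Ioc i₁ i₂ → ‖s‖ ≤ 1 / 2 ∧
      Module.End.HasEigenvalue (jacobi 1 (box n) 1 : ℓ^2(ℤ, ℂ) →ₗ[ℂ] ℓ^2(ℤ, ℂ))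
        (boxEnergy a (τ m) s) := fun m => by
    by_cases hm : m ∈ Finset.Ioc i₁ i₂
    · obtain ⟨s, hs⟩ := exists_eigenvalue ha han (m := m) rfl (h1' m hm) (h2' m hm)
      exact ⟨s, fun _ => hs⟩
    · exact ⟨0, fun h => absurd h hm⟩
  choose s hs using hex
  have hs1 : ∀ m ∈ Finset.Ioc i₁ i₂, ‖s m‖ ≤ 1 := fun m hm => (hs m hm).1.trans (by norm_num)
  have hinj : Set.InjOn (fun m => boxEnergy a (τ m) (s m)) (Finset.Ioc i₁ i₂) := by
    intro m hm m' hm' h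
    have hd := eq_of_boxEnergy_eq ha (h1' m hm) (h2' m hm) (hs m hm).1 (h1' m' hm') (h2' m' hm')
      (hs m' hm').1 h
    have e : τ m - τ m' = Real.pi * ((m : ℝ) - m') / n := by
      simp only [τ]
      ring
    rw [e, han, abs_div, abs_of_pos hn, div_le_div_iff_of_pos_right hn, abs_mul,
      abs_of_pos hpi] at hd
    have hlt : |((m : ℤ) : ℝ) - (m' : ℤ)| < 1 := by
      push_cast
      nlinarith [Real.pi_gt_three, abs_nonneg ((m : ℝ) - m')]
    have : |(m : ℤ) - m'| < 1 := by exact_mod_cast hlt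
    rw [Int.abs_lt_one_iff] at this
    omega
  have hsum := sum_weight_le_eigenvalueSum (p := p) (f := f) (Finset.Ioc i₁ i₂) _ hinj
    fun m hm => mem_discreteSpectrum_jacobi_box
      (im_boxEnergy_pos ha (h1' m hm) (h2' m hm) (hs1 m hm)) (hs m hm).2
  have hD : 0 < (n : ℝ) * ((n : ℝ) ^ (-2 / 3 : ℝ)) ^ p := by positivity
  rw [ratio, tsum_deviation_box hp, ENNReal.le_div_iff_mul_le
    (Or.inl (ENNReal.ofReal_pos.2 hD).ne') (Or.inl ENNReal.ofReal_ne_top),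
    ← ENNReal.ofReal_mul' hD.le]
  refine le_trans ?_ hsum
  have hw : ∀ m ∈ Finset.Ioc i₁ i₂,
      (1 / 2) ^ p / (16 * Real.pi) * (n * ((n : ℝ) ^ (-2 / 3 : ℝ)) ^ p) * (4 / (m + 1 / 2 : ℝ) *
        f (2 * Real.log (Real.pi / (2 * a ^ 2) * (m + 1 / 2)))) ≤
      weight p f (boxEnergy a (τ m) (s m)) := fun m hm => by
    refine le_trans (le_of_eq ?_) (le_weight_boxEnergy hp hf hf0 ha (h1' m hm) (h2' m hm)
      (hs1 m hm))
    rw [haτ, rpow_neg_two_thirds ha han, show 1 / (2 * a ^ 2) = 1 / 2 * (1 / a ^ 2) by ring,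
      Real.mul_rpow (by norm_num) (by positivity),
      show Real.pi / a ^ 2 * (m + 1 / 2) / 2 = Real.pi / (2 * a ^ 2) * (m + 1 / 2) by ring]
    simp only [τ]
    field_simp
    norm_num
  rw [← ENNReal.ofReal_sum_of_nonneg]
  · refine ENNReal.ofReal_le_ofReal ?_
    rw [mul_right_comm, Finset.mul_sum]
    exact Finset.sum_le_sum hw
  · intro m hm
    refine le_trans ?_ (hw m hm)
    have hlog : 0 ≤ 2 * Real.log (Real.pi / (2 * a ^ 2) * (m + 1 / 2)) := by
      refine mul_nonneg two_pos.le (Real.log_nonneg ?_)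
      have := h1' m hm
      rw [haτ] at this
      rw [show Real.pi / (2 * a ^ 2) * (m + 1 / 2) = Real.pi / a ^ 2 * (m + 1 / 2) / 2 by ring]
      linarith
    have := hf0 _ hlog
    positivity

theorem log_pi_sq_mul_sq (x : ℝ) :
    Real.log (Real.pi ^ 2 * x ^ 2) = 2 * Real.log (Real.pi * x) := by
  rw [← mul_pow, Real.log_pow]
  norm_num

/-- Non-asymptotic form: only `30 ≤ G` and `S` small compared with `a = n^{1/3}` are needed. -/
theorem primitive_sub_le_ratio_box {p : ℝ} (hp : 1 ≤ p) {f : ℝ → ℝ}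
    (hf : MonotoneOn f (Set.Ici 0)) (hf0 : ∀ t, 0 ≤ t → 0 < f t) {n : ℕ} {a : ℝ} (ha : 0 < a)
    (han : a ^ 3 = n) {G S : ℝ} (hG : 30 ≤ G) (hGS : G ≤ S) (hS : 3200 * S ≤ a) :
    ENNReal.ofReal ((1 / 2) ^ p / (16 * Real.pi) *
      (primitive f (Real.log (Real.pi ^ 2 * S ^ 2)) -
        primitive f (Real.log (Real.pi ^ 2 * G ^ 2)))) ≤ ratio p f 1 (box n) 1 := by
  have hpi := Real.pi_gt_three
  have hpi4 := Real.pi_lt_four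
  have hG0 : 0 < G := by linarith
  have hS0 : 0 < S := by linarith
  have ha1 : 1 ≤ a := by linarith
  have ha2 : 1 ≤ a ^ 2 := one_le_pow₀ ha1
  have hn : (0 : ℝ) < n := by
    rw [← han]
    positivity
  -- The range of summation is chosen such that the logarithmic interval covers `[πG, πS]`.
  obtain ⟨i₁, hi₁⟩ : ∃ i₁ : ℕ, i₁ + 1 = ⌊2 * a ^ 2 * G⌋₊ :=
    ⟨⌊2 * a ^ 2 * G⌋₊ - 1, Nat.sub_add_cancel ((Nat.one_le_floor_iff _).2 (by nlinarith))⟩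
  have hl₁ : (i₁ : ℝ) + 1 ≤ 2 * a ^ 2 * G := by
    have := Nat.floor_le (show 0 ≤ 2 * a ^ 2 * G by positivity)
    rw [← hi₁] at this
    exact_mod_cast this
  have hu₁ : 2 * a ^ 2 * G < i₁ + 2 := by
    have := Nat.lt_floor_add_one (2 * a ^ 2 * G)
    rw [← hi₁] at this
    push_cast at this
    linarith
  set i₂ := ⌈2 * a ^ 2 * S⌉₊
  have hl₂ : 2 * a ^ 2 * S ≤ i₂ := Nat.le_ceil _
  have hu₂ : (i₂ : ℝ) < 2 * a ^ 2 * S + 1 := Nat.ceil_lt_add_one (by positivity)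
  have haG : 30 ≤ a ^ 2 * G := by nlinarith
  have haGS : a ^ 2 * G ≤ a ^ 2 * S := by gcongr
  have hi₁' : a ^ 2 * G ≤ i₁ := by linarith
  have hi : i₁ ≤ i₂ := by
    have : (i₁ : ℝ) ≤ i₂ := by linarith
    exact_mod_cast this
  have h1i : 1 ≤ i₁ := by
    have : (1 : ℝ) ≤ i₁ := by linarith
    exact_mod_cast this
  have h1 : 30 ≤ Real.pi / a ^ 2 * (i₁ + 1 / 2) := by
    rw [div_mul_eq_mul_div, le_div_iff₀ (by positivity)]
    nlinarith
  have h2 : Real.pi * (i₂ + 1 / 2) / n ≤ 1 / 200 := by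
    rw [div_le_div_iff₀ hn (by norm_num), ← han]
    have e1 : Real.pi * (i₂ + 1 / 2) ≤ 4 * (2 * a ^ 2 * S + 3 / 2) :=
      mul_le_mul hpi4.le (by linarith) (by positivity) (by norm_num)
    have e2 : a ^ 2 * (3200 * S) ≤ a ^ 2 * a := by gcongr
    nlinarith
  have hlow : 1 ≤ Real.pi / (2 * a ^ 2) * (i₁ + 1 / 2) := by
    rw [show Real.pi / (2 * a ^ 2) * (i₁ + 1 / 2) = Real.pi / a ^ 2 * (i₁ + 1 / 2) / 2 by ring]
    linarith
  refine le_trans ?_ (sum_le_ratio_box hp hf hf0 ha han h1 h2)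
  refine ENNReal.ofReal_le_ofReal (mul_le_mul_of_nonneg_left ?_ (by positivity))
  refine le_trans ?_ (primitive_sub_le_sum hf hf0 (by positivity) h1i hlow hi)
  rw [log_pi_sq_mul_sq, log_pi_sq_mul_sq]
  refine sub_le_sub (primitive_mono hf hf0 ?_ ?_) (primitive_mono hf hf0 ?_ ?_)
  · exact mul_nonneg two_pos.le (Real.log_nonneg (by nlinarith))
  · refine mul_le_mul_of_nonneg_left (Real.log_le_log (by positivity) ?_) two_pos.le
    rw [div_mul_eq_mul_div, le_div_iff₀ (by positivity), mul_assoc]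
    exact mul_le_mul_of_nonneg_left (by linarith) Real.pi_pos.le
  · exact mul_nonneg two_pos.le (Real.log_nonneg hlow)
  · refine mul_le_mul_of_nonneg_left (Real.log_le_log (by positivity) ?_) two_pos.le
    rw [div_mul_eq_mul_div, div_le_iff₀ (by positivity), mul_assoc]
    exact mul_le_mul_of_nonneg_left (by linarith) Real.pi_pos.le

end JacobiLT

theorem mainTheorem10 (p : ℝ) (hp : 1 ≤ p) :
    ∃ C : ℝ, 0 < C ∧
      ∀ (ε γ x₀ : ℝ) (g : ℝ → ℝ),
        0 < ε → ε < 2 / 3 → 2 / 3 < γ → γ < 1 → 1 ≤ x₀ →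
        (∀ t : ℝ, 1 ≤ t → 1 ≤ g t) →
        Tendsto (fun n : ℕ => g n) atTop atTop →
        Tendsto (fun n : ℕ => g n / (n : ℝ) ^ (γ - 2 / 3)) atTop (𝓝 0) →
        ∃ N : ℕ, 2 ≤ N ∧ ∀ n : ℕ, N ≤ n → ∀ f : ℝ → ℝ,
          ContinuousOn f (Set.Ici 0) →
          MonotoneOn f (Set.Ici 0) →
          (∀ t : ℝ, 0 ≤ t → 0 < f t) →
          (MonotoneOn (fun t : ℝ => f (Real.log (t ^ 2)) / t) (Set.Ici x₀) ∨
            AntitoneOn (fun t : ℝ => f (Real.log (t ^ 2)) / t) (Set.Ici x₀)) →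
          JacobiLT.ratio p f 1 (JacobiLT.box n) 1 ≤ JacobiLT.supRatio p f ∧
          ENNReal.ofReal
              (C * (JacobiLT.primitive f (Real.log (Real.pi ^ 2 * (n : ℝ) ^ ε)) -
                JacobiLT.primitive f (Real.log (Real.pi ^ 2 * g n ^ 2)))) ≤
            JacobiLT.ratio p f 1 (JacobiLT.box n) 1 ∧
          ENNReal.ofReal (C * f 0 * Real.log ((n : ℝ) ^ ε / g n ^ 2)) ≤
            JacobiLT.ratio p f 1 (JacobiLT.box n) 1 ∧
          (g n ^ 2 ≤ (n : ℝ) ^ ε →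
            C * f 0 * Real.log ((n : ℝ) ^ ε / g n ^ 2) ≤
              C * (JacobiLT.primitive f (Real.log (Real.pi ^ 2 * (n : ℝ) ^ ε)) -
                JacobiLT.primitive f (Real.log (Real.pi ^ 2 * g n ^ 2)))) := by
  have hC : 0 < (1 / 2 : ℝ) ^ p / (16 * Real.pi) := by positivity
  refine ⟨(1 / 2) ^ p / (16 * Real.pi), hC, ?_⟩
  intro ε γ x₀ g hε hε' _ _ _ _ hg _
  have hlim : Tendsto (fun n : ℕ => (n : ℝ) ^ (-(1 / 3 - ε / 2))) atTop (𝓝 0) :=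
    (tendsto_rpow_neg_atTop (by linarith)).comp tendsto_natCast_atTop_atTop
  have hev : ∀ᶠ n : ℕ in atTop, 2 ≤ n ∧ 30 ≤ g n ∧ (n : ℝ) ^ (-(1 / 3 - ε / 2)) ≤ 1 / 3200 :=
    (eventually_ge_atTop 2).and ((hg.eventually_ge_atTop 30).and
      (hlim.eventually_le_const (by norm_num)))
  obtain ⟨N, hN⟩ := eventually_atTop.1 hev
  refine ⟨N, (hN N le_rfl).1, fun n hn f _ hf hf0 _ => ?_⟩
  obtain ⟨hn2, hG, hsmall⟩ := hN n hn
  have hn0 : (0 : ℝ) < n := by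
    have : 0 < n := by omega
    exact_mod_cast this
  have hn1 : (1 : ℝ) ≤ n := by
    have : 1 ≤ n := by omega
    exact_mod_cast this
  have hpi := Real.pi_gt_three
  have ha : 0 < (n : ℝ) ^ (1 / 3 : ℝ) := Real.rpow_pos_of_pos hn0 _
  have han : ((n : ℝ) ^ (1 / 3 : ℝ)) ^ 3 = n := by
    rw [← Real.rpow_natCast, ← Real.rpow_mul hn0.le]
    norm_num
  have hS0 : 0 < (n : ℝ) ^ (ε / 2) := Real.rpow_pos_of_pos hn0 _
  have hS2 : ((n : ℝ) ^ (ε / 2)) ^ 2 = (n : ℝ) ^ ε := by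
    rw [← Real.rpow_natCast, ← Real.rpow_mul hn0.le]
    norm_num
  have hS : 3200 * (n : ℝ) ^ (ε / 2) ≤ (n : ℝ) ^ (1 / 3 : ℝ) := by
    have e : (n : ℝ) ^ (ε / 2) = (n : ℝ) ^ (-(1 / 3 - ε / 2)) * (n : ℝ) ^ (1 / 3 : ℝ) := by
      rw [← Real.rpow_add hn0]
      ring_nf
    rw [e]
    nlinarith
  have hE1 : 1 ≤ (n : ℝ) ^ ε := Real.one_le_rpow hn1 hε.le
  have hE0 : 0 < (n : ℝ) ^ ε := by linarith
  have hG2 : 0 < g n ^ 2 := by nlinarith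
  have hlogdiv : Real.log ((n : ℝ) ^ ε / g n ^ 2) =
      Real.log (Real.pi ^ 2 * (n : ℝ) ^ ε) - Real.log (Real.pi ^ 2 * g n ^ 2) := by
    rw [← Real.log_div (by positivity) (by positivity), mul_div_mul_left _ _ (by positivity)]
  have hlogG : 0 ≤ Real.log (Real.pi ^ 2 * g n ^ 2) := Real.log_nonneg
    (one_le_mul_of_one_le_of_one_le (one_le_pow₀ (by linarith)) (one_le_pow₀ (by linarith)))
  have hlogE : 0 ≤ Real.log (Real.pi ^ 2 * (n : ℝ) ^ ε) := Real.log_nonneg (by nlinarith)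
  have hcompare : g n ^ 2 ≤ (n : ℝ) ^ ε →
      (1 / 2) ^ p / (16 * Real.pi) * f 0 * Real.log ((n : ℝ) ^ ε / g n ^ 2) ≤
        (1 / 2) ^ p / (16 * Real.pi) *
          (JacobiLT.primitive f (Real.log (Real.pi ^ 2 * (n : ℝ) ^ ε)) -
            JacobiLT.primitive f (Real.log (Real.pi ^ 2 * g n ^ 2))) := fun hle => by
    rw [mul_assoc, hlogdiv, mul_comm (f 0)]
    refine mul_le_mul_of_nonneg_left (JacobiLT.le_primitive_sub hf hlogG ?_) hC.le
    gcongr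
  refine ⟨JacobiLT.ratio_box_le_supRatio f (by omega), ?_⟩
  rcases le_total (g n ^ 2) ((n : ℝ) ^ ε) with hle | hle
  · have hGS : g n ≤ (n : ℝ) ^ (ε / 2) :=
      le_of_sq_le_sq (by rwa [hS2]) hS0.le
    have hmain := JacobiLT.primitive_sub_le_ratio_box hp hf hf0 ha han hG hGS hS
    rw [hS2] at hmain
    exact ⟨hmain, (ENNReal.ofReal_le_ofReal (hcompare hle)).trans hmain, hcompare⟩
  · -- Here both lower bounds are nonpositive.
    refine ⟨?_, ?_, hcompare⟩
    · rw [ENNReal.ofReal_of_nonpos]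
      · exact zero_le
      · refine mul_nonpos_of_nonneg_of_nonpos hC.le
          (sub_nonpos.2 (JacobiLT.primitive_mono hf hf0 hlogE ?_))
        gcongr
    · rw [ENNReal.ofReal_of_nonpos]
      · exact zero_le
      · refine mul_nonpos_of_nonneg_of_nonpos (mul_pos hC (hf0 0 le_rfl)).le
          (Real.log_nonpos (by positivity) ?_)
        exact (div_le_one hG2).2 hle
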